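/- All rings are commutative. Let $R$ be a Dedekind domain with fraction field $K=Q(R)$. An \emph{order} over $R$ is an $R$-algebra $A$ that is finitely generated and torsion-free as an $R$-module and whose total quotient ring $Q(A)=A\otimes_R K$ is a finite étale $K$-algebra (that is, finite-dimensional with non-degenerate trace form $(x,y)\mapsto \mathrm{Tr}_{Q(A)/K}(xy)$). Write $A^{\dagger}=\{x\in Q(A): \mathrm{Tr}_{Q(A)/K}(xA)\subseteq R\}$ for the trace dual of $A$ and $\overline{A}$ for the integral closure of $A$ in $Q(A)$; one has $A\subseteq\overline{A}\subseteq A^{\dagger}$ (this is included in the conclusions below). \textbf{(1) Local statement.} Let $R$ be a discrete valuation ring with maximal ideal $\mathfrak{p}$ and $\mathrm{char}(R/\mathfrak{p})\neq 2$, let $A$ be an order over $R$, and let $B=A^{\dagger}/A$. Suppose that $B$ is cyclic as an $R$-module, or that $B$ is generated by two elements as an $R$-module and $\mathrm{length}_R(B)$ is odd. Then $$\overline{A}/A=\mathrm{lr}(B):=\sum_{k\ge 0}\bigl(\mathfrak{p}^kB\cap B[\mathfrak{p}^k]\bigr),\qquad B[\mathfrak{p}^k]=\{b\in B:\mathfrak{p}^kb=0\}.$$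 \textbf{(2) Global statement.} Let $A$ be an order over $\mathbb{Z}$ and let $B=A^{\dagger}/A$. Suppose that $B$ is finite, that $\#B$ is odd, and that $B\cong\mathbb{Z}/m\mathbb{Z}\times\mathbb{Z}/m'\mathbb{Z}$ with positive integers $m=\prod_p p^{n(p)}$ and $m'=\prod_p p^{n'(p)}$ such that for every prime $p$ one has $n(p)n'(p)=0$ or $n(p)+n'(p)$ is odd. Then $$\overline{A}/A=\mathrm{lr}(B):=\sum_{r\in\mathbb{Z}}\bigl(rB\cap B[r]\bigr),\qquad B[r]=\{b\in B: rb=0\}.$$ \textbf{(3)} In particular, if $\alpha$ is an algebraic integer, $K=\mathbb{Q}(\alpha)$, $A=\mathbb{Z}[\alpha]$, $A^{\dagger}=\{x\in K:\mathrm{Tr}_{K/\mathbb{Q}}(xA)\subseteq\mathbb{Z}\}$, $\overline{A}=\mathcal{O}_K$, and $B=A^{\dagger}/A$ satisfies the conditions in (2), then $\overline{A}/A=\mathrm{lr}(B)$. -/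

import Mathlib

/-- A finite étale algebra `Q` over a field `K`: finite-dimensional, and the trace form
`(x, y) ↦ Tr_{Q/K}(xy)` is non-degenerate. -/
def IsFiniteEtaleAlgebra (K Q : Type*) [Field K] [CommRing Q] [Algebra K Q] : Prop :=
  Module.Finite K Q ∧ (Algebra.traceForm K Q).Nondegenerate

/-- `A` is an order over the Dedekind domain `R`. Here `K` is the fraction field of `R` and `Q` is
the total quotient ring of `A` (the localization of `A` at all its non-zero-divisors), regarded as a
`K`-algebra compatibly with the map `R → A`. -/
structure IsOrderOver (R A K Q : Type*) [CommRing R] [IsDedekindDomain R] [CommRing A] [Algebra R A]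
    [Field K] [Algebra R K] [IsFractionRing R K]
    [CommRing Q] [Algebra A Q] [IsFractionRing A Q] [Algebra K Q] : Prop where
  finite : Module.Finite R A
  torsionFree : Module.IsTorsionFree R A
  etale : IsFiniteEtaleAlgebra K Q

section Order

variable (R A K Q : Type*) [CommRing R] [CommRing A] [Algebra R A] [Field K] [Algebra R K]
  [CommRing Q] [Algebra A Q] [Algebra K Q] [Algebra R Q] [IsScalarTower R A Q] [IsScalarTower R K Q]

/-- The image of `A` in `Q`, as an `R`-submodule. -/
def orderSubmodule : Submodule R Q :=
  LinearMap.range (IsScalarTower.toAlgHom R A Q).toLinearMap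

/-- The trace dual `M† = {x ∈ Q | Tr_{Q/K}(xM) ⊆ R}` of an `R`-submodule `M` of `Q`. -/
noncomputable def traceDualSubmodule (M : Submodule R Q) : Submodule R Q where
  carrier := {x | ∀ y ∈ M, Algebra.trace K Q (x * y) ∈ (algebraMap R K).range}
  zero_mem' := fun y _ => by simp
  add_mem' := fun {a b} ha hb y hy => by
    rw [add_mul, map_add]
    exact add_mem (ha y hy) (hb y hy)
  smul_mem' := fun r x hx y hy => by
    rw [smul_mul_assoc, ← mul_smul_comm]
    exact hx _ (M.smul_mem r hy)

/-- The trace dual `A†` of `A`. -/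
noncomputable def orderDual : Submodule R Q := traceDualSubmodule R K Q (orderSubmodule R A Q)

/-- The integral closure `Ā` of `A` in `Q`, as an `R`-submodule. -/
noncomputable def orderClosure : Submodule R Q :=
  Subalgebra.toSubmodule ((integralClosure A Q).restrictScalars R)

/-- The `R`-module `A†/A`. -/
abbrev DualQuotient : Type _ :=
  (orderDual R A K Q) ⧸ (orderSubmodule R A Q).submoduleOf (orderDual R A K Q)

/-- For `M` with `A ⊆ M ⊆ A†`, the submodule `M/A` of `A†/A`. -/
noncomputable def quotientSubmodule (M : Submodule R Q) : Submodule R (DualQuotient R A K Q) :=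
  (M.submoduleOf (orderDual R A K Q)).map
    ((orderSubmodule R A Q).submoduleOf (orderDual R A K Q)).mkQ

/-- `A ⊆ Ā ⊆ A†`, and `Ā/A` is the given submodule `L` of `A†/A`. -/
def ClosureQuotientEq (L : Submodule R (DualQuotient R A K Q)) : Prop :=
  orderSubmodule R A Q ≤ orderClosure R A Q ∧
  orderClosure R A Q ≤ orderDual R A K Q ∧
  quotientSubmodule R A K Q (orderClosure R A Q) = L

end Order

/-- The lower root `∑_k (𝔪^k M ∩ M[𝔪^k])` of a module `M` over a local ring with maximal ideal `𝔪`.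
If `𝔪^n M = 0` then the terms with `k > n` are zero, so the sum over all `k` is the sum over
`0 ≤ k ≤ n`. -/
noncomputable def lowerRoot (R M : Type*) [CommRing R] [IsLocalRing R] [AddCommGroup M]
    [Module R M] : Submodule R M :=
  ⨆ k : ℕ, (IsLocalRing.maximalIdeal R ^ k • (⊤ : Submodule R M)) ⊓
    Submodule.torsionBySet R M ((IsLocalRing.maximalIdeal R ^ k : Ideal R) : Set R)

/-- The lower root `∑_{r ∈ ℤ} (rB ∩ B[r])` of an abelian group `B`. -/
noncomputable def lowerRootInt (B : Type*) [AddCommGroup B] [Module ℤ B] : Submodule ℤ B :=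
  ⨆ r : ℤ, LinearMap.range (LinearMap.lsmul ℤ B r) ⊓ Submodule.torsionBy ℤ B r

/-- `B ≅ ℤ/m × ℤ/m'` has odd order, where `m = ∏ p^{n(p)}` and `m' = ∏ p^{n'(p)}` are positive
integers such that for all primes `p` one has `n(p)n'(p) = 0` or `n(p) + n'(p)` is odd. -/
def IsOddAlternating (B : Type*) [AddCommGroup B] : Prop :=
  Odd (Nat.card B) ∧ ∃ m m' : ℕ, 0 < m ∧ 0 < m' ∧ Nonempty (B ≃+ ZMod m × ZMod m') ∧
    ∀ p : ℕ, p.Prime → m.factorization p * m'.factorization p = 0 ∨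
      Odd (m.factorization p + m'.factorization p)

/-! Over a discrete valuation ring with uniformizer `ϖ`, let `O` be the integral closure and `D =
O†`. Traces of integral elements are integral, so `A ⊆ O ⊆ D ⊆ A†`. The trace form makes `B = A†/A`
a module with a nondegenerate symmetric `K/R`-valued form, in which `O/A` is isotropic with
orthogonal complement `D/A`.

The lower root `L` of `B` is isotropic in general (`lowerRootLattice_isotropic`). Conversely, since
`2` is a unit, the form can be diagonalised on two generators `e`, `f` (`exists_isOrthogonalPair`).
If their orders `ϖ^i`, `ϖ^j` have `i + j` odd, then `a²(e,e) + b²(f,f)` is integral only if both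
terms are, because the valuations have different parity. Hence every isotropic vector lies in `L`
(`mem_lowerRootLattice`), and the cyclic case is the same with `f = 0`. In particular `O ⊆ L`, and
then `L ⊆ L† ⊆ D`.

The arithmetic input is tameness: `ϖD ⊆ O` (`smul_mem_integralClosure_of_mem_traceDualSubmodule`).
Thus `D/O` is a vector space over the residue field, of dimension at most two, with a nondegenerate
form. A vector of `L` outside `O` would be a nonzero isotropic vector there. This is impossible in
dimension one; in dimension two it would span its own orthogonal complement and give a self-dual
lattice, which odd length forbids (`not_self_dual`). So `L = O`.

Tameness rests on the equality `O ∩ ϖD = J`, with `J` the radical of `ϖO`. Nilpotents have trace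
zero, which gives one inclusion. For the other, a non-nilpotent element of the radical of the trace
form mod `ϖ` yields a nonzero idempotent whose rank is zero in the residue field; the rank is then
at least three, as the characteristic is not two, whereas the radical has dimension at most two. A
short computation in the nilpotent algebra `J/ϖO`, of dimension at most two, together with the fact
that `O` contains every multiplier of `J`, finishes (`dvd_of_mem_radical_of_primitive_relations`).

Over `ℤ` both lattices are compared after localizing at each prime dividing `#B`. The ring `ℤ[α]` is
a special case. -/

set_option linter.unusedSectionVars false

/-! ### Trace duality of lattices and integrality of traces. -/

section TraceDual

open Submodule

variable {R K Q : Type*} [CommRing R] [Field K] [Algebra R K]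
  [CommRing Q] [Algebra K Q] [Algebra R Q] [IsScalarTower R K Q]

theorem mem_traceDualSubmodule {M : Submodule R Q} {x : Q} :
    x ∈ traceDualSubmodule R K Q M ↔
      ∀ y ∈ M, Algebra.trace K Q (x * y) ∈ (algebraMap R K).range := Iff.rfl

theorem traceDualSubmodule_anti {M N : Submodule R Q} (h : M ≤ N) :
    traceDualSubmodule R K Q N ≤ traceDualSubmodule R K Q M :=
  fun _ hx y hy => hx y (h hy)

theorem traceDualSubmodule_eq_dualSubmodule (M : Submodule R Q) :
    traceDualSubmodule R K Q M = (Algebra.traceForm K Q).dualSubmodule M := by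
  ext x
  simp [mem_traceDualSubmodule, LinearMap.BilinForm.mem_dualSubmodule, Algebra.traceForm_apply,
    Submodule.mem_one]

theorem le_traceDualSubmodule_comm {M N : Submodule R Q} (h : M ≤ traceDualSubmodule R K Q N) :
    N ≤ traceDualSubmodule R K Q M :=
  fun x hx y hy => by rw [mul_comm]; exact h hy x hx

theorem mem_range_smul {z : K} (hz : z ∈ (algebraMap R K).range) (r : R) :
    r • z ∈ (algebraMap R K).range := by
  rw [Algebra.smul_def]
  exact mul_mem ⟨r, rfl⟩ hz

theorem trace_smul' (r : R) (x : Q) : Algebra.trace K Q (r • x) = r • Algebra.trace K Q x := by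
  rw [← IsScalarTower.algebraMap_smul K r x, map_smul, algebraMap_smul]

/-- The trace dual of a subalgebra is stable under multiplication by the subalgebra. -/
theorem mul_mem_traceDualSubmodule {S : Subalgebra R Q} {x s : Q}
    (hx : x ∈ traceDualSubmodule R K Q (Subalgebra.toSubmodule S)) (hs : s ∈ S) :
    x * s ∈ traceDualSubmodule R K Q (Subalgebra.toSubmodule S) := fun y hy => by
  rw [mul_assoc]
  exact hx _ (S.mul_mem hs hy)

variable [IsDomain R] [IsPrincipalIdealRing R] [IsFractionRing R K]

theorem Submodule.IsLattice.exists_basis (M : Submodule R Q) [IsLattice K M] :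
    ∃ (n : ℕ) (b : Module.Basis (Fin n) R M), M = span R (Set.range (b.extendOfIsLattice K)) := by
  have : Module.IsTorsionFree R K := inferInstance
  have := IsLattice.finite K M
  have : Module.Free R M := IsLattice.free K M
  refine ⟨_, Module.finBasis R M, ?_⟩
  have h : Set.range ((Module.finBasis R M).extendOfIsLattice K) =
      M.subtype '' Set.range (Module.finBasis R M) := by
    rw [← Set.range_comp]
    congr 1
    ext i
    simp
  rw [h, ← map_span, Module.Basis.span_eq, map_top, range_subtype]

/-- Over a principal ideal domain a lattice is free, and the dual of a lattice is spanned by the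
dual basis for the nondegenerate trace form, so biduality is that of bases. -/
theorem traceDualSubmodule_traceDualSubmodule (hQ : (Algebra.traceForm K Q).Nondegenerate)
    (M : Submodule R Q) [IsLattice K M] :
    traceDualSubmodule R K Q (traceDualSubmodule R K Q M) = M := by
  obtain ⟨n, b, hb⟩ := IsLattice.exists_basis (K := K) M
  simp only [traceDualSubmodule_eq_dualSubmodule]
  conv_lhs => rw [hb]
  rw [LinearMap.BilinForm.dualSubmodule_dualSubmodule_of_basis _ hQ
    (Algebra.traceForm_isSymm K), ← hb]

theorem traceDualSubmodule_fg (hQ : (Algebra.traceForm K Q).Nondegenerate)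
    (M : Submodule R Q) [IsLattice K M] : (traceDualSubmodule R K Q M).FG := by
  obtain ⟨n, b, hb⟩ := IsLattice.exists_basis (K := K) M
  rw [traceDualSubmodule_eq_dualSubmodule, hb,
    LinearMap.BilinForm.dualSubmodule_span_of_basis _ hQ]
  exact fg_span (Set.finite_range _)

/-- The trace of an element of a subalgebra that is a lattice can be computed over `R`. -/
theorem algebraMap_trace_of_isLattice (S : Subalgebra R Q)
    [IsLattice K (Subalgebra.toSubmodule S)] (x : S) :
    algebraMap R K (Algebra.trace R S x) = Algebra.trace K Q (x : Q) := by
  obtain ⟨n, b, -⟩ := IsLattice.exists_basis (K := K) (Subalgebra.toSubmodule S)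
  have key : ∀ (y : S) (i : Fin n), algebraMap R K (b.repr y i) =
      (b.extendOfIsLattice K).repr (y : Q) i := by
    intro y i
    have hy : ∑ j, algebraMap R K (b.repr y j) • b.extendOfIsLattice K j = (y : Q) := by
      have h := congrArg (Subalgebra.toSubmodule S).subtype (b.sum_repr y)
      rw [map_sum] at h
      simpa [-Module.Basis.sum_repr] using h
    rw [← hy, map_sum, Finsupp.finsetSum_apply]
    simp only [map_smul, Module.Basis.repr_self, Finsupp.smul_apply, Finsupp.single_apply,
      smul_eq_mul, mul_ite, mul_one, mul_zero, Finset.sum_ite_eq', Finset.mem_univ, if_true]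
  rw [Algebra.trace_eq_matrix_trace (b.extendOfIsLattice K),
    Algebra.trace_eq_matrix_trace (R := R) (S := S) b, Matrix.trace, Matrix.trace, map_sum]
  refine Finset.sum_congr rfl fun i _ => ?_
  rw [Matrix.diag_apply, Matrix.diag_apply, Algebra.leftMulMatrix_eq_repr_mul,
    Algebra.leftMulMatrix_eq_repr_mul]
  erw [key]
  simp

theorem trace_mem_range_of_isLattice {S : Subalgebra R Q}
    [IsLattice K (Subalgebra.toSubmodule S)] {x : Q} (hx : x ∈ S) :
    Algebra.trace K Q x ∈ (algebraMap R K).range :=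
  ⟨_, algebraMap_trace_of_isLattice (K := K) S ⟨x, hx⟩⟩

/-- Enlarging the order by one integral element keeps it finite over `R`. The trace of that element
is then the trace of a matrix over `R`, and `R` need not be compared with minimal polynomials over
`K`. -/
theorem isLattice_sup_adjoin (A : Subalgebra R Q) [IsLattice K (Subalgebra.toSubmodule A)]
    {x : Q} (hx : IsIntegral R x) :
    IsLattice K (Subalgebra.toSubmodule (A ⊔ Algebra.adjoin R {x})) := by
  refine IsLattice.of_le_of_isLattice_of_fg K (M := Subalgebra.toSubmodule A)
    (Subalgebra.toSubmodule.monotone le_sup_left) ?_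
  rw [← Subalgebra.mul_toSubmodule]
  exact (IsLattice.fg (A := K)).mul hx.fg_adjoin_singleton

/-- If `Q` has a subalgebra that is a lattice, then integral elements have integral trace. -/
theorem trace_mem_range_of_isIntegral (A : Subalgebra R Q)
    [IsLattice K (Subalgebra.toSubmodule A)] {x : Q} (hx : IsIntegral R x) :
    Algebra.trace K Q x ∈ (algebraMap R K).range := by
  have := isLattice_sup_adjoin (K := K) A hx
  exact trace_mem_range_of_isLattice (S := A ⊔ Algebra.adjoin R {x})
    (le_sup_right (a := A) (Algebra.self_mem_adjoin_singleton R x))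

theorem le_integralClosure_of_isLattice (A : Subalgebra R Q)
    [IsLattice K (Subalgebra.toSubmodule A)] : A ≤ integralClosure R Q := fun x hx =>
  IsIntegral.of_mem_of_fg A IsLattice.fg x hx

theorem integralClosure_le_traceDualSubmodule (A : Subalgebra R Q)
    [IsLattice K (Subalgebra.toSubmodule A)] :
    Subalgebra.toSubmodule (integralClosure R Q) ≤
      traceDualSubmodule R K Q (Subalgebra.toSubmodule (integralClosure R Q)) :=
  fun _ hx _ hy => trace_mem_range_of_isIntegral A (IsIntegral.mul hx hy)

theorem traceDualSubmodule_integralClosure_le (A : Subalgebra R Q)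
    [IsLattice K (Subalgebra.toSubmodule A)] :
    traceDualSubmodule R K Q (Subalgebra.toSubmodule (integralClosure R Q)) ≤
      traceDualSubmodule R K Q (Subalgebra.toSubmodule A) :=
  traceDualSubmodule_anti (le_integralClosure_of_isLattice (K := K) A)

theorem isLattice_of_le_of_le (hQ : (Algebra.traceForm K Q).Nondegenerate)
    (M N : Submodule R Q) [IsLattice K M] (h : M ≤ N) (h' : N ≤ traceDualSubmodule R K Q M) :
    IsLattice K N := by
  refine IsLattice.of_le_of_isLattice_of_fg K h ?_
  have : Module.Finite R (traceDualSubmodule R K Q M) :=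
    Module.Finite.iff_fg.2 (traceDualSubmodule_fg hQ M)
  have := isNoetherian_of_le h'
  exact Module.Finite.iff_fg.1 inferInstance

/-- The closure lies between `A` and the finitely generated module `A†`, so it is finite because `R`
is noetherian. -/
theorem isLattice_integralClosure (hQ : (Algebra.traceForm K Q).Nondegenerate)
    (A : Subalgebra R Q) [IsLattice K (Subalgebra.toSubmodule A)] :
    IsLattice K (Subalgebra.toSubmodule (integralClosure R Q)) :=
  isLattice_of_le_of_le hQ (Subalgebra.toSubmodule A) _ (le_integralClosure_of_isLattice (K := K) A)
    ((integralClosure_le_traceDualSubmodule A).trans (traceDualSubmodule_integralClosure_le A))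

end TraceDual

/-! ### Divisibility by a uniformizer inside the radical it generates. -/

theorem dvd_of_dvd_mul_unit_add_radical {O : Type*} [CommRing O] {t w u j : O} (hu : IsUnit u)
    (hj : j ∈ (Ideal.span {t}).radical) (h : t ∣ w * (u + j)) : t ∣ w := by
  obtain ⟨n, hn⟩ := hj
  have hnil : IsNilpotent (Ideal.Quotient.mk (Ideal.span {t}) j) :=
    ⟨n, by rw [← map_pow]; exact Ideal.Quotient.eq_zero_iff_mem.2 hn⟩
  have hunit := hnil.isUnit_add_left_of_commute (hu.map (Ideal.Quotient.mk (Ideal.span {t})))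
    (Commute.all _ _)
  rw [← Ideal.mem_span_singleton, ← Ideal.Quotient.eq_zero_iff_mem] at h ⊢
  rw [map_mul, map_add] at h
  exact (hunit.mul_left_eq_zero).1 h

/-- An element `w` of the radical `J` of `(t)` such that `wj/t` is in `J` as soon as it exists, for
all `j` in `J`, is divisible by `t` if `J/(t)` has rank at most two and the multiplier ring of `J`
is trivial. -/
theorem dvd_of_mem_radical_of_primitive_relations {R O : Type*} [CommRing R] [CommRing O]
    [Algebra R O] {ϖ : R} (hϖ : ∀ r : R, ¬ IsUnit r → ϖ ∣ r) {t w : O}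
    (ht : t = algebraMap R O ϖ) (hw : w ∈ (Ideal.span {t}).radical)
    (hrel : ∀ v : Fin 3 → O, (∀ i, v i ∈ (Ideal.span {t}).radical) →
      ∃ r : Fin 3 → R, (∃ i, IsUnit (r i)) ∧ t ∣ ∑ i, r i • v i)
    (hmult : ∀ v : O, (∀ j ∈ (Ideal.span {t}).radical,
      ∃ i ∈ (Ideal.span {t}).radical, v * j = t * i) → t ∣ v)
    (hdiv : ∀ j ∈ (Ideal.span {t}).radical, t ∣ w * j →
      ∃ i ∈ (Ideal.span {t}).radical, w * j = t * i) : t ∣ w := by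
  set J := (Ideal.span {t}).radical with hJ
  have hnu : ∀ r : R, ¬ IsUnit r → ∀ x : O, t ∣ r • x := by
    rintro r hr x
    obtain ⟨s, rfl⟩ := hϖ r hr
    rw [Algebra.smul_def, map_mul, ← ht, mul_assoc]
    exact Dvd.intro _ rfl
  have hsmulu : ∀ r : R, IsUnit r → ∀ x : O, t ∣ r • x → t ∣ x := by
    rintro r ⟨u, rfl⟩ x hx
    have := hx.mul_left (algebraMap R O ↑u⁻¹)
    rwa [← Algebra.smul_def, smul_smul, Units.inv_mul, one_smul] at this
  have hnil : ∀ (r : R), IsUnit r → ∀ j ∈ J, ∀ x, t ∣ x * (algebraMap R O r + j) → t ∣ x :=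
    fun r hr j hj x hx => dvd_of_dvd_mul_unit_add_radical (hr.map _) hj hx
  by_contra hcon
  -- Everything is read in the nilpotent algebra `J/(t)`, where three elements are always dependent.
  -- If `w²` were nonzero there, `w` and `w²` would form a basis and `w³` would vanish.
  have hw2 : t ∣ w ^ 2 := by
    by_contra hcon2
    have hw2J : w ^ 2 ∈ J := J.pow_mem_of_mem hw 2 two_pos
    -- A relation whose terms are all multiples of `w` has the shape `w * (r + nilpotent)`; with `r`
    -- a unit it would force `t ∣ w`.
    have hcase : ∀ (r s : R) (c : O), c ∈ J → t ∣ w * (algebraMap R O r + c) + s • w ^ 2 →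
        ¬ IsUnit r := by
      intro r s c hc h hu
      refine hcon (hnil r hu _ (J.add_mem hc (J.mul_mem_left (algebraMap R O s) hw)) w ?_)
      convert h using 1
      rw [Algebra.smul_def]
      ring
    have hw3 : t ∣ w * w ^ 2 := by
      obtain ⟨r, hr, h⟩ := hrel ![w, w ^ 2, w * w ^ 2] (by
        intro i; fin_cases i
        · exact hw
        · exact hw2J
        · exact J.mul_mem_left _ hw2J)
      simp only [Fin.sum_univ_three, Matrix.cons_val] at h
      have h0 : ¬ IsUnit (r 0) := by
        refine hcase _ (r 1) _ (J.mul_mem_left (algebraMap R O (r 2)) hw2J) ?_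
        convert h using 1
        simp only [Algebra.smul_def]
        ring
      have h1 : ¬ IsUnit (r 1) := by
        intro hu
        refine hcon2 (hnil _ hu _ (J.mul_mem_left (algebraMap R O (r 2)) hw) _ ?_)
        have e : r 0 • w + r 1 • w ^ 2 + r 2 • (w * w ^ 2) =
            r 0 • w + w ^ 2 * (algebraMap R O (r 1) + algebraMap R O (r 2) * w) := by
          simp only [Algebra.smul_def]; ring
        rw [e] at h
        exact (dvd_add_right (hnu _ h0 _)).1 h
      have h2 : IsUnit (r 2) := by
        obtain ⟨i, hi⟩ := hr
        fin_cases i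
        · contradiction
        · contradiction
        · exact hi
      exact hsmulu _ h2 _ ((dvd_add_right ((hnu _ h0 _).add (hnu _ h1 _))).1 h)
    have hgen : ∀ j ∈ J, ∃ a b c : O, j = a * w + b * w ^ 2 + t * c := by
      intro j hj
      obtain ⟨r, hr, h⟩ := hrel ![w, w ^ 2, j] (by
        intro i; fin_cases i
        · exact hw
        · exact hw2J
        · exact hj)
      simp only [Fin.sum_univ_three, Matrix.cons_val] at h
      have h2 : IsUnit (r 2) := by
        by_contra h2
        rw [dvd_add_left (hnu _ h2 _)] at h
        have h0 : ¬ IsUnit (r 0) := by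
          refine hcase _ (r 1) _ J.zero_mem ?_
          convert h using 1
          simp only [Algebra.smul_def]
          ring
        have h1 : ¬ IsUnit (r 1) := fun hu =>
          hcon2 (hsmulu _ hu _ ((dvd_add_right (hnu _ h0 _)).1 h))
        obtain ⟨i, hi⟩ := hr
        fin_cases i <;> contradiction
      obtain ⟨u, hu⟩ := h2
      obtain ⟨c, hc⟩ := h
      have hinv : algebraMap R O ↑u⁻¹ * algebraMap R O (r 2) = 1 := by
        rw [← hu, ← map_mul, Units.inv_mul, map_one]
      refine ⟨-(algebraMap R O ↑u⁻¹ * algebraMap R O (r 0)),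
        -(algebraMap R O ↑u⁻¹ * algebraMap R O (r 1)), algebraMap R O ↑u⁻¹ * c, ?_⟩
      simp only [Algebra.smul_def] at hc
      linear_combination (-j) * hinv + algebraMap R O ↑u⁻¹ * hc
    obtain ⟨i, hi, hi'⟩ := hdiv _ hw2J hw3
    -- Since `w³ = t i` with `i ∈ J` and `J` is generated by `w`, `w²`, `t`, multiplication by `w²`
    -- maps `J` into `tJ`.
    refine hcon2 (hmult _ fun j hj => ?_)
    obtain ⟨a, b, c, rfl⟩ := hgen j hj
    refine ⟨i * a + i * w * b + w ^ 2 * c, J.add_mem (J.add_mem (J.mul_mem_right _ hi)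
      (J.mul_mem_right _ (J.mul_mem_right _ hi))) (J.mul_mem_right _ hw2J), ?_⟩
    linear_combination (a + b * w) * hi'
  -- With `w² = 0` modulo `t`, a nonzero product `wj` would make `w`, `j`, `wj` independent:
  -- multiplying a relation by `w` isolates the coefficient of `j`, and the other two follow by
  -- nilpotence.
  have hwJ : ∀ j ∈ J, t ∣ w * j := by
    intro j hj
    by_contra hcon3
    obtain ⟨r, hr, h⟩ := hrel ![w, j, w * j] (by
      intro i; fin_cases i
      · exact hw
      · exact hj
      · exact J.mul_mem_left _ hj)
    simp only [Fin.sum_univ_three, Matrix.cons_val] at h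
    have h1 : ¬ IsUnit (r 1) := by
      intro hu
      refine hcon3 (hsmulu _ hu _ ?_)
      have h' := h.mul_left w
      have e : w * (r 0 • w + r 1 • j + r 2 • (w * j)) =
          w ^ 2 * (algebraMap R O (r 0) + r 2 • j) + r 1 • (w * j) := by
        simp only [Algebra.smul_def]; ring
      rw [e] at h'
      exact (dvd_add_right (hw2.mul_right _)).1 h'
    have h0 : ¬ IsUnit (r 0) := by
      intro hu
      refine hcon (hnil _ hu _ (J.mul_mem_left (algebraMap R O (r 2)) hj) _ ?_)
      have e : r 0 • w + r 1 • j + r 2 • (w * j) =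
          w * (algebraMap R O (r 0) + algebraMap R O (r 2) * j) + r 1 • j := by
        simp only [Algebra.smul_def]; ring
      rw [e] at h
      exact (dvd_add_left (hnu _ h1 _)).1 h
    have h2 : ¬ IsUnit (r 2) := fun hu => hcon3 (hsmulu _ hu _
      ((dvd_add_right ((hnu _ h0 _).add (hnu _ h1 _))).1 h))
    obtain ⟨i, hi⟩ := hr
    fin_cases i <;> contradiction
  exact hcon (hmult w fun j hj => hdiv j hj (hwJ j hj))

/-! ### A bound on the number of generators that passes to subquotients. -/

section PrimitiveRelations

/-- Any `n` elements of `N` satisfy a linear relation modulo `M` with a unit coefficient. -/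
def HasPrimitiveRelations {R Q : Type*} [CommRing R] [AddCommGroup Q] [Module R Q] (n : ℕ)
    (M N : Submodule R Q) : Prop :=
  ∀ v : Fin n → Q, (∀ i, v i ∈ N) → ∃ r : Fin n → R, (∃ i, IsUnit (r i)) ∧ ∑ i, r i • v i ∈ M

variable {R Q : Type*} [CommRing R] [AddCommGroup Q] [Module R Q]

theorem HasPrimitiveRelations.mono {n : ℕ} {M N M' N' : Submodule R Q}
    (h : HasPrimitiveRelations n M N) (hM : M ≤ M') (hN : N' ≤ N) :
    HasPrimitiveRelations n M' N' := fun v hv =>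
  let ⟨r, hr, hr'⟩ := h v fun i => hN (hv i)
  ⟨r, hr, hM hr'⟩

/-- More vectors than the rank are dependent. Dividing a relation by the gcd of its coefficients
leaves coefficients generating the unit ideal, so one of them is a unit in a local ring. -/
theorem exists_primitive_relation [IsDomain R] [IsPrincipalIdealRing R] [IsLocalRing R]
    {m n : ℕ} (hmn : m < n) (a : Fin n → Fin m → R) :
    ∃ r : Fin n → R, (∃ i, IsUnit (r i)) ∧ ∑ i, r i • a i = 0 := by
  have hdep : ¬ LinearIndependent R a := fun h => by
    have := h.fintype_card_le_finrank
    simp at this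
    omega
  obtain ⟨s, hs, i₀, hi₀⟩ := Fintype.not_linearIndependent_iff.1 hdep
  obtain ⟨g, hg⟩ := (IsPrincipalIdealRing.principal (Ideal.span (Set.range s))).principal
  have hmem : ∀ i, ∃ r, r * g = s i := fun i => by
    have : s i ∈ Ideal.span (Set.range s) := Ideal.subset_span ⟨i, rfl⟩
    rw [hg] at this
    exact Submodule.mem_span_singleton.1 this
  choose r hr using hmem
  have hg0 : g ≠ 0 := by
    rintro rfl
    exact hi₀ (by rw [← hr i₀, mul_zero])
  refine ⟨r, ?_, ?_⟩
  · have : g ∈ Ideal.span (Set.range s) := hg ▸ Submodule.mem_span_singleton_self g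
    obtain ⟨c, hc⟩ := (Ideal.mem_span_range_iff_exists_fun).1 this
    by_contra! hcon
    have hsum : ∑ i, c i * r i ∈ IsLocalRing.maximalIdeal R :=
      Ideal.sum_mem _ fun i _ => Ideal.mul_mem_left _ _ (hcon i)
    have h1 : ∑ i, c i * r i = 1 := by
      refine mul_right_cancel₀ hg0 ?_
      rw [one_mul, Finset.sum_mul]
      refine Eq.trans (Finset.sum_congr rfl fun i _ => ?_) hc
      rw [mul_assoc, hr]
    rw [h1] at hsum
    exact hsum isUnit_one
  · have : g • ∑ i, r i • a i = 0 := by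
      rw [← hs, Finset.smul_sum]
      exact Finset.sum_congr rfl fun i _ => by rw [smul_smul, mul_comm, hr]
    exact (smul_eq_zero.1 this).resolve_left hg0

theorem hasPrimitiveRelations_of_le_span_sup [IsDomain R] [IsPrincipalIdealRing R] [IsLocalRing R]
    {m n : ℕ} (hmn : m < n) {M N : Submodule R Q} (e : Fin m → Q)
    (h : N ≤ Submodule.span R (Set.range e) ⊔ M) : HasPrimitiveRelations n M N := by
  intro v hv
  have : ∀ i, ∃ a : Fin m → R, v i - ∑ j, a j • e j ∈ M := fun i => by
    obtain ⟨y, hy, z, hz, hyz⟩ := Submodule.mem_sup.1 (h (hv i))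
    obtain ⟨a, rfl⟩ := (Submodule.mem_span_range_iff_exists_fun R).1 hy
    exact ⟨a, by rwa [← hyz, add_sub_cancel_left]⟩
  choose a ha using this
  obtain ⟨r, hr, hra⟩ := exists_primitive_relation hmn a
  refine ⟨r, hr, ?_⟩
  have h0 : ∑ i, r i • ∑ j, a i j • e j = 0 := by
    simp only [Finset.smul_sum, smul_smul]
    rw [Finset.sum_comm]
    refine Finset.sum_eq_zero fun j _ => ?_
    rw [← Finset.sum_smul]
    have := congrFun hra j
    simp only [Finset.sum_apply, Pi.smul_apply, smul_eq_mul, Pi.zero_apply] at this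
    rw [this, zero_smul]
  have := M.sum_mem (t := Finset.univ) fun i _ => M.smul_mem (r i) (ha i)
  simpa only [smul_sub, Finset.sum_sub_distrib, h0, sub_zero] using this

end PrimitiveRelations

/-! ### The radical of the trace form modulo the uniformizer. -/

section Tame

open Submodule IsLocalRing

variable {R K Q : Type*} [CommRing R] [IsDomain R] [IsDiscreteValuationRing R]
  [Field K] [Algebra R K] [IsFractionRing R K]
  [CommRing Q] [Algebra K Q] [Algebra R Q] [IsScalarTower R K Q]

/-- The chain of ideals `(x^n)` stabilises, say `x^n = x^(n+1) y`; then `x^(n+1) y^(n+1)` is an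
idempotent acting as the identity on `x^(n+1)`. It vanishes only if `x` is nilpotent. -/
theorem exists_idempotent_pow_mul {E : Type*} [CommRing E] [IsArtinianRing E] (x : E) :
    ∃ (n : ℕ) (c : E), IsIdempotentElem (x ^ (n + 1) * c) ∧
      x ^ (n + 1) * (x ^ (n + 1) * c) = x ^ (n + 1) := by
  obtain ⟨n, y, h⟩ := IsArtinian.exists_pow_succ_smul_dvd x (1 : E)
  simp only [smul_eq_mul, mul_one, Nat.succ_eq_add_one] at h
  have h' : ∀ m, x ^ (n + m) * y ^ m = x ^ n := by
    intro m
    induction m with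
    | zero => simp
    | succ m ih =>
      rw [← ih, show x ^ (n + (m + 1)) * y ^ (m + 1) =
        (x ^ (n + 1) * y) * (x ^ m * y ^ m) by ring, h]
      ring
  have h2 : x ^ (n + 1) * (x ^ (n + 1) * y ^ (n + 1)) = x ^ (n + 1) := by
    conv_rhs => rw [pow_succ, ← h' (n + 1)]
    ring
  refine ⟨n, y ^ (n + 1), ?_, h2⟩
  rw [IsIdempotentElem]
  conv_rhs => rw [← h2]
  ring

/-- A nonzero idempotent of trace zero generates an ideal of dimension at least three if `2 ≠ 0`. -/
theorem exists_linearIndependent_mul_of_trace_eq_zero {k E : Type*} [Field k] [CommRing E]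
    [Algebra k E] [Module.Finite k E] (h2 : (2 : k) ≠ 0) {ε : E} (hid : IsIdempotentElem ε)
    (h0 : ε ≠ 0) (htr : Algebra.trace k E ε = 0) :
    ∃ v : Fin 3 → E, LinearIndependent k fun i => ε * v i := by
  set f := Algebra.lmul k E ε with hf
  have hproj : LinearMap.IsProj (LinearMap.range f) f := by
    refine ⟨fun z => ⟨z, rfl⟩, ?_⟩
    rintro _ ⟨z, rfl⟩
    simp only [hf, Algebra.coe_lmul_eq_mul, LinearMap.mul_apply']
    rw [← mul_assoc, hid.eq]
  have hrank := hproj.trace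
  rw [Algebra.trace_apply] at htr
  rw [hf, htr] at hrank
  have hpos : 0 < Module.finrank k (LinearMap.range f) := by
    rw [Module.finrank_pos_iff_exists_ne_zero]
    exact ⟨⟨f 1, 1, rfl⟩, fun h => h0 (by simpa [hf] using congrArg Subtype.val h)⟩
  -- The trace of a projection is its rank, so the rank is zero in `k`; ranks one and two are
  -- nonzero there.
  have hge : 3 ≤ Module.finrank k (LinearMap.range f) := by
    by_contra! hlt
    rw [← hf] at hrank
    generalize Module.finrank k (LinearMap.range f) = d at *
    interval_cases d
    · simp at hrank
    · exact h2 hrank.symm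
  obtain ⟨v, hv⟩ := exists_linearIndependent_of_le_finrank hge
  choose z hz using fun i => (v i).2
  refine ⟨z, ?_⟩
  have := hv.map' (LinearMap.range f).subtype (LinearMap.range f).ker_subtype
  rwa [show (fun i => ε * z i) = (LinearMap.range f).subtype ∘ v from funext hz]

theorem map_maximalIdeal_eq_span {ϖ : R} (hϖ : Irreducible ϖ) (S : Subalgebra R Q) :
    (maximalIdeal R).map (algebraMap R S) = Ideal.span {algebraMap R S ϖ} := by
  rw [hϖ.maximalIdeal_eq, Ideal.map_span, Set.image_singleton]

attribute [local instance] Ideal.Quotient.field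

/-- If `2` is invertible and `S†/S` has rank at most two, then the radical of the trace form of `S`
modulo `ϖ` consists of nilpotent elements. -/
theorem mem_radical_of_mem_traceDualSubmodule {ϖ : R} (hϖ : Irreducible ϖ) (h2 : IsUnit (2 : R))
    (S : Subalgebra R Q) [IsLattice K (Subalgebra.toSubmodule S)]
    (hrel : HasPrimitiveRelations 3 (Subalgebra.toSubmodule S)
      (traceDualSubmodule R K Q (Subalgebra.toSubmodule S)))
    {y : Q} (hy : y ∈ traceDualSubmodule R K Q (Subalgebra.toSubmodule S)) {x : S}
    (hx : (x : Q) = ϖ • y) : x ∈ (Ideal.span {algebraMap R S ϖ}).radical := by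
  have hfin : Module.Finite R S := IsLattice.finite K (Subalgebra.toSubmodule S)
  have htf : Module.IsTorsionFree R K := inferInstance
  have hfree : Module.Free R S := IsLattice.free K (Subalgebra.toSubmodule S)
  rw [← map_maximalIdeal_eq_span hϖ]
  set I := (maximalIdeal R).map (algebraMap R S) with hI
  have : Module.Finite (R ⧸ maximalIdeal R) (S ⧸ I) :=
    Module.Finite.of_restrictScalars_finite R _ _
  have : IsArtinianRing (S ⧸ I) := IsArtinianRing.of_finite (R ⧸ maximalIdeal R) (S ⧸ I)
  obtain ⟨n, c, hid, hc⟩ := exists_idempotent_pow_mul (Ideal.Quotient.mk I x)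
  obtain ⟨c, rfl⟩ := Ideal.Quotient.mk_surjective c
  set e : S := x ^ (n + 1) * c with he
  have hee : Ideal.Quotient.mk I x ^ (n + 1) * Ideal.Quotient.mk I c = Ideal.Quotient.mk I e := by
    simp [he]
  rw [hee] at hid hc
  by_cases h0 : Ideal.Quotient.mk I e = 0
  · refine ⟨n + 1, ?_⟩
    rw [← Ideal.Quotient.eq_zero_iff_mem, map_pow, ← hc, h0, mul_zero]
  exfalso
  -- The idempotent is a multiple of `x`, so the whole ideal it generates lies in `ϖS†`. This gives
  -- both its zero trace and, by dividing by `ϖ`, elements of `S†` to which the rank bound applies.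
  have hediv : ∀ z : S, ∃ w ∈ traceDualSubmodule R K Q (Subalgebra.toSubmodule S),
      ((e * z : S) : Q) = ϖ • w := fun z => by
    refine ⟨y * ((x ^ n * c * z : S) : Q), mul_mem_traceDualSubmodule hy (x ^ n * c * z : S).2, ?_⟩
    rw [← smul_mul_assoc, ← hx, ← S.coe_mul]
    congr 1
    rw [he]; ring
  have htr : Algebra.trace (R ⧸ maximalIdeal R) (S ⧸ I) (Ideal.Quotient.mk I e) = 0 := by
    rw [Algebra.trace_quotient_mk, Ideal.Quotient.eq_zero_iff_mem, hϖ.maximalIdeal_eq,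
      Ideal.mem_span_singleton]
    obtain ⟨w, hw, hw'⟩ := hediv 1
    obtain ⟨r, hr⟩ := hw 1 S.one_mem
    refine ⟨r, FaithfulSMul.algebraMap_injective R K ?_⟩
    rw [algebraMap_trace_of_isLattice S e, ← mul_one e, hw', trace_smul', map_mul, hr, mul_one,
      Algebra.smul_def]
  have h2' : (2 : R ⧸ maximalIdeal R) ≠ 0 := fun h =>
    (Ideal.Quotient.eq_zero_iff_mem (I := maximalIdeal R) (a := (2 : R))).1 h h2
  obtain ⟨v, hv⟩ := exists_linearIndependent_mul_of_trace_eq_zero h2' hid h0 htr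
  choose z hz using fun i => Ideal.Quotient.mk_surjective (v i)
  choose w hw hzw using fun i => hediv (z i)
  obtain ⟨r, ⟨i, hi⟩, hr⟩ := hrel w hw
  have hsum : ∑ i, (Ideal.Quotient.mk (maximalIdeal R) (r i)) •
      (Ideal.Quotient.mk I e * v i) = 0 := by
    have : ∑ i, r i • (e * z i) ∈ I := by
      rw [hI, map_maximalIdeal_eq_span hϖ, Ideal.mem_span_singleton]
      refine ⟨⟨_, hr⟩, Subtype.ext ?_⟩
      simp only [AddSubmonoidClass.coe_finsetSum, S.coe_smul, hzw]
      rw [S.coe_mul, S.coe_algebraMap, ← Algebra.smul_def, Finset.smul_sum]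
      exact Finset.sum_congr rfl fun i _ => smul_comm _ _ _
    rw [← Ideal.Quotient.eq_zero_iff_mem, map_sum] at this
    rw [← this]
    refine Finset.sum_congr rfl fun i _ => ?_
    rw [← hz, Algebra.smul_def, Algebra.smul_def, map_mul, map_mul]
    rfl
  have := Fintype.linearIndependent_iff.1 hv _ hsum i
  rw [Ideal.Quotient.eq_zero_iff_mem] at this
  exact this hi

/-- Elements of `S` that are nilpotent modulo `ϖ` are divisible by `ϖ` in the trace dual. -/
theorem exists_eq_smul_of_mem_radical {ϖ : R} (hϖ : Irreducible ϖ)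
    (S : Subalgebra R Q) [IsLattice K (Subalgebra.toSubmodule S)] {x : S}
    (hx : x ∈ (Ideal.span {algebraMap R S ϖ}).radical) :
    ∃ y ∈ traceDualSubmodule R K Q (Subalgebra.toSubmodule S), (x : Q) = ϖ • y := by
  have hfin : Module.Finite R S := IsLattice.finite K (Subalgebra.toSubmodule S)
  have htf : Module.IsTorsionFree R K := inferInstance
  have hfree : Module.Free R S := IsLattice.free K (Subalgebra.toSubmodule S)
  have hϖK : algebraMap R K ϖ ≠ 0 := by simpa using hϖ.ne_zero
  refine ⟨(algebraMap R K ϖ)⁻¹ • (x : Q), fun y hy => ?_, ?_⟩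
  -- Each product `x * y` is nilpotent modulo `ϖ`, so its trace vanishes in the residue field and is
  -- divisible by `ϖ`.
  · have hmem := Ideal.mul_mem_right ⟨y, hy⟩ _ hx
    rw [← map_maximalIdeal_eq_span hϖ] at hmem
    obtain ⟨n, hn⟩ := hmem
    have hnil : IsNilpotent (Ideal.Quotient.mk ((maximalIdeal R).map (algebraMap R S))
        (x * ⟨y, hy⟩)) := ⟨n, by rw [← map_pow]; exact Ideal.Quotient.eq_zero_iff_mem.2 hn⟩
    have := (Algebra.isNilpotent_trace_of_isNilpotent (R := R ⧸ maximalIdeal R) hnil).eq_zero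
    rw [Algebra.trace_quotient_mk, Ideal.Quotient.eq_zero_iff_mem, hϖ.maximalIdeal_eq,
      Ideal.mem_span_singleton] at this
    obtain ⟨r, hr⟩ := this
    refine ⟨r, ?_⟩
    have h := algebraMap_trace_of_isLattice (K := K) S (x * ⟨y, hy⟩)
    rw [hr, map_mul] at h
    rw [smul_mul_assoc, map_smul, smul_eq_mul, eq_inv_mul_iff_mul_eq₀ hϖK, h]
    rfl
  · rw [← IsScalarTower.algebraMap_smul K ϖ, smul_smul, mul_inv_cancel₀ hϖK, one_smul]

end Tame

/-! ### Tameness of the integral closure. -/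

section InverseDifferent

open Submodule IsLocalRing

theorem Submodule.IsLattice.exists_smul_mem {R K Q : Type*} [CommRing R] [IsDomain R]
    [Field K] [Algebra R K] [IsFractionRing R K] [AddCommGroup Q] [Module K Q] [Module R Q]
    [IsScalarTower R K Q] (M : Submodule R Q) [IsLattice K M] (x : Q) :
    ∃ r : R, r ≠ 0 ∧ r • x ∈ M := by
  have hx : x ∈ span K (M : Set Q) := by rw [IsLattice.span_eq_top]; trivial
  induction hx using span_induction with
  | mem x hx => exact ⟨1, one_ne_zero, by rwa [one_smul]⟩
  | zero => exact ⟨1, one_ne_zero, by simp⟩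
  | add x y _ _ ihx ihy =>
    obtain ⟨r, hr, hrx⟩ := ihx
    obtain ⟨s, hs, hsy⟩ := ihy
    refine ⟨r * s, mul_ne_zero hr hs, ?_⟩
    rw [smul_add, mul_comm, mul_smul, mul_comm, mul_smul]
    exact M.add_mem (M.smul_mem _ hrx) (M.smul_mem _ hsy)
  | smul k x _ ih =>
    obtain ⟨r, hr, hrx⟩ := ih
    obtain ⟨a, b, hb, rfl⟩ := IsFractionRing.div_surjective (A := R) k
    have hb0 := nonZeroDivisors.ne_zero hb
    refine ⟨r * b, mul_ne_zero hr hb0, ?_⟩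
    have hbK : algebraMap R K b ≠ 0 := by simpa using hb0
    have e : (r * b) • (algebraMap R K a / algebraMap R K b) • x = a • r • x := by
      simp only [← IsScalarTower.algebraMap_smul K (_ : R) (_ : Q), smul_smul, map_mul]
      congr 1
      field_simp
    rw [e]
    exact M.smul_mem _ hrx

variable {R K Q : Type*} [CommRing R] [IsDomain R]
  [Field K] [Algebra R K] [IsFractionRing R K]
  [CommRing Q] [Algebra K Q] [Algebra R Q] [IsScalarTower R K Q]

/-- An element that multiplies a finitely generated submodule containing a regular scalar into
itself is integral. -/
theorem isIntegral_of_forall_mul_mem {R Q : Type*} [CommRing R] [CommRing Q] [Algebra R Q]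
    {N : Submodule R Q} (hN : N.FG) {r : R} (hr : ∀ z : Q, r • z = 0 → z = 0)
    (hrN : algebraMap R Q r ∈ N) {x : Q} (hx : ∀ n ∈ N, x * n ∈ N) : IsIntegral R x := by
  have := Module.Finite.iff_fg.2 hN
  let f : Module.End R N := (LinearMap.mulLeft R x).restrict hx
  obtain ⟨p, hp, hpf⟩ := LinearMap.exists_monic_and_aeval_eq_zero R f
  refine ⟨p, hp, ?_⟩
  have hcoe : ∀ (q : Polynomial R) (n : N), ((Polynomial.aeval f q n : N) : Q) =
      Polynomial.aeval x q * n := by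
    intro q n
    induction q using Polynomial.induction_on generalizing n with
    | C a => simp [Algebra.smul_def]
    | add p q hp hq => simp [hp, hq, add_mul]
    -- By induction a polynomial in `f` acts as multiplication by the same polynomial in `x`.
    -- Evaluating the Cayley–Hamilton relation at the regular scalar `r` then gives `p(x) = 0`.
    | monomial k a ih =>
      rw [pow_succ, ← mul_assoc, map_mul, Module.End.mul_apply, ih, map_mul _ _ Polynomial.X,
        Polynomial.aeval_X, Polynomial.aeval_X, show ((f n : N) : Q) = x * n from rfl, mul_assoc]
  have h0 := hcoe p ⟨_, hrN⟩
  rw [hpf, LinearMap.zero_apply, mul_comm, ← Algebra.smul_def] at h0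
  exact hr _ h0.symm

variable [IsDiscreteValuationRing R]

/-- If `2` is invertible and `S†/S` has rank at most two, where `S` is the integral closure of `R`,
then `ϖS† ⊆ S`. -/
theorem smul_mem_integralClosure_of_mem_traceDualSubmodule {ϖ : R} (hϖ : Irreducible ϖ)
    (h2 : IsUnit (2 : R)) [IsLattice K (Subalgebra.toSubmodule (integralClosure R Q))]
    (hrel : HasPrimitiveRelations 3 (Subalgebra.toSubmodule (integralClosure R Q))
      (traceDualSubmodule R K Q (Subalgebra.toSubmodule (integralClosure R Q)))) {y : Q}
    (hy : y ∈ traceDualSubmodule R K Q (Subalgebra.toSubmodule (integralClosure R Q))) :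
    ϖ • y ∈ integralClosure R Q := by
  set S := integralClosure R Q with hS
  set t : S := algebraMap R S ϖ with ht
  have hinj : ∀ {x z : Q}, ϖ • x = ϖ • z → x = z := by
    intro x z h
    have hϖK : algebraMap R K ϖ ≠ 0 := by simpa using hϖ.ne_zero
    rw [← IsScalarTower.algebraMap_smul K ϖ, ← IsScalarTower.algebraMap_smul K ϖ z] at h
    exact smul_right_injective Q hϖK h
  have htmul : ∀ s : S, ((t * s : S) : Q) = ϖ • (s : Q) := fun s => by
    rw [S.coe_mul, ht, S.coe_algebraMap, Algebra.smul_def]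
  -- One power of `ϖ` is removed at a time. The element `w = ϖ²y` lies in `ϖS† ∩ S`, hence in the
  -- radical, and divisibility of `w` by `ϖ` is exactly `ϖy ∈ S`.
  have step : ∀ y ∈ traceDualSubmodule R K Q (Subalgebra.toSubmodule S),
      ϖ • ϖ • y ∈ S → ϖ • y ∈ S := by
    intro y hy hyS
    set w : S := ⟨ϖ • ϖ • y, hyS⟩ with hw
    have hdvd : t ∣ w := by
      refine dvd_of_mem_radical_of_primitive_relations (R := R) (ϖ := ϖ) (fun r hr => ?_) ht
        ?_ ?_ ?_ ?_
      · have : r ∈ maximalIdeal R := hr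
        rwa [hϖ.maximalIdeal_eq, Ideal.mem_span_singleton] at this
      · exact mem_radical_of_mem_traceDualSubmodule hϖ h2 S hrel
          (smul_mem (traceDualSubmodule R K Q (Subalgebra.toSubmodule S)) ϖ hy) rfl
      · intro v hv
        choose u hu hvu using fun i => exists_eq_smul_of_mem_radical (K := K) hϖ S (hv i)
        obtain ⟨r, hr, hr'⟩ := hrel u hu
        refine ⟨r, hr, ⟨_, hr'⟩, Subtype.ext ?_⟩
        rw [htmul]
        simp only [AddSubmonoidClass.coe_finsetSum, S.coe_smul, hvu, Finset.smul_sum]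
        exact Finset.sum_congr rfl fun i _ => smul_comm _ _ _
      · intro v hv
        set J := (Ideal.span {t}).radical with hJ
        have htJ : t ∈ J := Ideal.le_radical (Ideal.mem_span_singleton_self t)
        obtain ⟨i, -, hi⟩ := hv t htJ
        have hϖK : algebraMap R K ϖ ≠ 0 := by simpa using hϖ.ne_zero
        set x : Q := (algebraMap R K ϖ)⁻¹ • (v : Q) with hx
        have hvx : (v : Q) = ϖ • x := by
          rw [← IsScalarTower.algebraMap_smul K ϖ, smul_smul, mul_inv_cancel₀ hϖK, one_smul]
        -- The quotient `x = v/ϖ` maps the finitely generated module `J` to itself and `J` contains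
        -- the regular element `ϖ`, so `x` is integral and already in `S`.
        have hnoeth : IsNoetherian R S :=
          have := IsLattice.finite K (Subalgebra.toSubmodule S)
          isNoetherian_of_isNoetherianRing_of_finite R S
        have hfg : ((J.restrictScalars R).map S.val.toLinearMap).FG :=
          (IsNoetherian.noetherian _).map _
        have hxS : IsIntegral R x := by
          refine isIntegral_of_forall_mul_mem hfg (r := ϖ)
            (fun z hz => hinj (by rw [hz, smul_zero])) ⟨t, htJ, rfl⟩ ?_
          rintro _ ⟨j, hj, rfl⟩
          obtain ⟨i, hi, hij⟩ := hv j hj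
          refine ⟨i, hi, hinj ?_⟩
          have := congrArg Subtype.val hij
          rw [htmul, S.coe_mul, hvx] at this
          rw [← smul_mul_assoc]
          exact this.symm
        exact ⟨⟨x, hxS⟩, Subtype.ext (by rw [htmul, hvx])⟩
      -- Here `i = ϖ y j` with `y j ∈ S†`, so `i` again lies in the radical.
      · rintro j - ⟨i, hi⟩
        refine ⟨i, mem_radical_of_mem_traceDualSubmodule hϖ h2 S hrel
          (mul_mem_traceDualSubmodule hy j.2) (hinj ?_), hi⟩
        rw [← htmul, ← hi, S.coe_mul, hw, smul_mul_assoc, smul_mul_assoc]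
    obtain ⟨s, hs⟩ := hdvd
    have := congrArg Subtype.val hs
    rw [htmul] at this
    rw [hinj this]
    exact s.2
  obtain ⟨r, hr, hry⟩ := IsLattice.exists_smul_mem (K := K) (Subalgebra.toSubmodule S) y
  obtain ⟨n, u, rfl⟩ := IsDiscreteValuationRing.eq_unit_mul_pow_irreducible hr hϖ
  have hn : ϖ ^ n • y ∈ S := by
    have := S.smul_mem hry (↑u⁻¹ : R)
    rwa [smul_smul, ← mul_assoc, Units.inv_mul, one_mul] at this
  clear hry hr
  induction n with
  | zero =>
    rw [pow_zero, one_smul] at hn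
    exact S.smul_mem hn ϖ
  | succ n ih =>
    cases n with
    | zero => simpa using hn
    | succ n =>
      refine ih ?_
      rw [pow_succ', mul_smul]
      refine step _ (smul_mem _ _ hy) ?_
      rw [pow_succ', pow_succ', mul_smul, mul_smul] at hn
      exact hn

end InverseDifferent

/-! ### Valuations and parity. -/

section Uniformizer

variable {R : Type*} [CommRing R] [IsDomain R] [IsDiscreteValuationRing R] {ϖ : R}

theorem not_pow_mul_unit_add_eq (hϖ : Irreducible ϖ) {p q s : ℕ} {u v c : R} (hu : IsUnit u)
    (hq : p < q) (hs : p < s) : u * ϖ ^ p + v * ϖ ^ q ≠ c * ϖ ^ s := by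
  intro h
  obtain ⟨q, rfl⟩ := Nat.exists_eq_add_of_lt hq
  obtain ⟨s, rfl⟩ := Nat.exists_eq_add_of_lt hs
  have h' : u = ϖ * (c * ϖ ^ s - v * ϖ ^ q) := by
    refine mul_right_cancel₀ (pow_ne_zero p hϖ.ne_zero) ?_
    linear_combination h
  exact hϖ.not_isUnit (isUnit_of_dvd_unit ⟨_, h'⟩ hu)

theorem le_of_pow_mul_unit_add_eq (hϖ : Irreducible ϖ) {p q s : ℕ} {u v c : R} (hu : IsUnit u)
    (hv : IsUnit v) (hpq : p ≠ q) (h : u * ϖ ^ p + v * ϖ ^ q = c * ϖ ^ s) : s ≤ p := by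
  by_contra! hs
  rcases hpq.lt_or_gt with hlt | hlt
  · exact not_pow_mul_unit_add_eq hϖ hu hlt hs h
  · exact not_pow_mul_unit_add_eq hϖ hv hlt (hlt.trans hs) (by rw [add_comm]; exact h)

theorem pow_dvd_of_pow_dvd_sq (hϖ : Irreducible ϖ) {h : ℕ} {a : R}
    (ha : ϖ ^ (2 * h + 1) ∣ a ^ 2) : ϖ ^ (h + 1) ∣ a := by
  rcases eq_or_ne a 0 with rfl | h0
  · exact dvd_zero _
  obtain ⟨k, u, rfl⟩ := IsDiscreteValuationRing.eq_unit_mul_pow_irreducible h0 hϖ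
  rw [mul_pow, ← pow_mul, ← Units.val_pow_eq_pow_val, Units.dvd_mul_left,
    pow_dvd_pow_iff hϖ.ne_zero hϖ.not_isUnit] at ha
  rw [Units.dvd_mul_left]
  exact pow_dvd_pow _ (by omega)

variable {K : Type*} [Field K] [Algebra R K] [IsFractionRing R K]

theorem exists_eq_smul_or_eq_smul (x y : K) : ∃ r : R, x = r • y ∨ y = r • x := by
  rcases eq_or_ne y 0 with rfl | hy
  · exact ⟨0, Or.inr (by simp)⟩
  rcases eq_or_ne x 0 with rfl | hx
  · exact ⟨0, Or.inl (by simp)⟩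
  rcases (ValuationRing.iff_isInteger_or_isInteger R K).1 inferInstance (x / y) with ⟨r, hr⟩ | ⟨r, hr⟩
  · exact ⟨r, Or.inl (by rw [Algebra.smul_def, hr, div_mul_cancel₀ _ hy])⟩
  · refine ⟨r, Or.inr ?_⟩
    rw [Algebra.smul_def, hr, inv_div, div_mul_cancel₀ _ hx]

/-- The exponent is the order of the pole of `z`, truncated at zero; integral `z`, including `z =
0`, get `n = 0`. This is why `exists_unit_pow_smul_eq` needs `n ≠ 0`. -/
theorem exists_smul_mem_range_iff_pow_dvd (hϖ : Irreducible ϖ) (z : K) :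
    ∃ n : ℕ, ∀ a : R, a • z ∈ (algebraMap R K).range ↔ ϖ ^ n ∣ a := by
  obtain ⟨r, hr | hr⟩ := exists_eq_smul_or_eq_smul (R := R) z 1
  · refine ⟨0, fun a => ⟨fun _ => by simp, fun _ => ⟨a * r, ?_⟩⟩⟩
    rw [hr, map_mul, Algebra.smul_def, Algebra.smul_def, mul_one]
  · have hr0 : r ≠ 0 := by
      rintro rfl
      simp at hr
    obtain ⟨n, u, rfl⟩ := IsDiscreteValuationRing.eq_unit_mul_pow_irreducible hr0 hϖ
    have hz : z ≠ 0 := by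
      rintro rfl
      simp at hr
    rw [Algebra.smul_def] at hr
    refine ⟨n, fun a => ⟨?_, ?_⟩⟩
    · rintro ⟨c, hc⟩
      rw [Algebra.smul_def] at hc
      refine ⟨u * c, FaithfulSMul.algebraMap_injective R K ?_⟩
      refine mul_right_cancel₀ hz ?_
      rw [← hc, show ϖ ^ n * (u * c) = (u * ϖ ^ n) * c by ring, map_mul]
      linear_combination algebraMap R K c * hr
    · rintro ⟨c, rfl⟩
      refine ⟨↑u⁻¹ * c, ?_⟩
      rw [Algebra.smul_def]
      have hu : algebraMap R K ↑u⁻¹ * algebraMap R K u = 1 := by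
        rw [← map_mul, Units.inv_mul, map_one]
      rw [map_mul] at hr
      simp only [map_mul]
      linear_combination (algebraMap R K ↑u⁻¹ * algebraMap R K c) * hr +
        (algebraMap R K c) * algebraMap R K (ϖ ^ n) * z * hu

theorem exists_unit_pow_smul_eq (hϖ : Irreducible ϖ) {z : K} {n : ℕ}
    (hz : ∀ a : R, a • z ∈ (algebraMap R K).range ↔ ϖ ^ n ∣ a) (hn : n ≠ 0) :
    ∃ u : R, IsUnit u ∧ algebraMap R K u = ϖ ^ n • z := by
  obtain ⟨u, hu⟩ := (hz (ϖ ^ n)).2 dvd_rfl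
  refine ⟨u, ?_, hu⟩
  by_contra hnu
  have hmem : u ∈ IsLocalRing.maximalIdeal R := hnu
  rw [hϖ.maximalIdeal_eq, Ideal.mem_span_singleton] at hmem
  obtain ⟨c, rfl⟩ := hmem
  obtain ⟨m, rfl⟩ := Nat.exists_eq_succ_of_ne_zero hn
  have hϖK : algebraMap R K ϖ ≠ 0 := by simpa using hϖ.ne_zero
  have : ϖ ^ m • z ∈ (algebraMap R K).range := by
    refine ⟨c, mul_left_cancel₀ hϖK ?_⟩
    rw [← map_mul, hu, Algebra.smul_def, Algebra.smul_def, pow_succ, map_mul]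
    ring
  rw [hz, pow_dvd_pow_iff hϖ.ne_zero hϖ.not_isUnit] at this
  omega

/-- If `x` and `y` have valuations of different parity, then `a²x + b²y` can be integral only if
both terms are. -/
theorem sq_smul_mem_range_of_add_mem_range (hϖ : Irreducible ϖ) {x y : K} {i j : ℕ}
    (hx : ∀ a : R, a • x ∈ (algebraMap R K).range ↔ ϖ ^ i ∣ a)
    (hy : ∀ a : R, a • y ∈ (algebraMap R K).range ↔ ϖ ^ j ∣ a) (hij : Odd (i + j)) {a b : R}
    (h : a ^ 2 • x + b ^ 2 • y ∈ (algebraMap R K).range) :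
    a ^ 2 • x ∈ (algebraMap R K).range := by
  rcases eq_or_ne i 0 with rfl | hi
  · exact (hx _).2 (by simp)
  rcases eq_or_ne j 0 with rfl | hj
  · exact (add_mem_cancel_right ((hy _).2 (by simp))).1 h
  rcases eq_or_ne a 0 with rfl | ha
  · simp
  rcases eq_or_ne b 0 with rfl | hb
  · simpa using h
  obtain ⟨u, hu, hux⟩ := exists_unit_pow_smul_eq hϖ hx hi
  obtain ⟨v, hv, hvy⟩ := exists_unit_pow_smul_eq hϖ hy hj
  obtain ⟨c, hc⟩ := h
  obtain ⟨k, a, rfl⟩ := IsDiscreteValuationRing.eq_unit_mul_pow_irreducible ha hϖ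
  obtain ⟨l, b, rfl⟩ := IsDiscreteValuationRing.eq_unit_mul_pow_irreducible hb hϖ
  -- Multiplying by `ϖ^(i+j)` clears both poles. The two exponents on the left differ in parity, so
  -- no cancellation occurs and `i + j ≤ 2k + j`.
  have key : (a ^ 2 * u : R) * ϖ ^ (2 * k + j) + (b ^ 2 * v) * ϖ ^ (2 * l + i) =
      c * ϖ ^ (i + j) := by
    apply FaithfulSMul.algebraMap_injective R K
    simp only [Algebra.smul_def] at hux hvy hc
    simp only [map_mul, map_add, map_pow] at hux hvy hc ⊢
    rw [hux, hvy, hc]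
    ring
  have hle := le_of_pow_mul_unit_add_eq hϖ ((a.isUnit.pow 2).mul hu) ((b.isUnit.pow 2).mul hv)
    (by rintro h; obtain ⟨t, ht⟩ := hij; omega) key
  rw [hx, mul_pow, ← pow_mul]
  exact (pow_dvd_pow ϖ (by omega)).mul_left _

end Uniformizer

/-! ### Length of a module with two diagonal generators. -/

section Length

open Submodule

theorem length_quotient_span_pow {R : Type*} [CommRing R] [IsDomain R] [IsDiscreteValuationRing R]
    {ϖ : R} (hϖ : Irreducible ϖ) (n : ℕ) : Module.length R (R ⧸ Ideal.span {ϖ ^ n}) = n := by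
  have := Ring.ord_pow (mem_nonZeroDivisors_of_ne_zero hϖ.ne_zero) n
  rw [Ring.ord_of_irreducible hϖ, nsmul_one] at this
  exact this

/-- The length of a quotient with two generators and diagonal relations. -/
theorem length_quotient_of_generators {R Q : Type*} [CommRing R] [IsDomain R]
    [IsDiscreteValuationRing R] [AddCommGroup Q] [Module R Q] {ϖ : R} (hϖ : Irreducible ϖ)
    {M N : Submodule R Q} {e f : Q} (he : e ∈ N) (hf : f ∈ N) (h : N ≤ span R {e, f} ⊔ M)
    {i j : ℕ} (hij : ∀ a b : R, a • e + b • f ∈ M ↔ ϖ ^ i ∣ a ∧ ϖ ^ j ∣ b) :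
    Module.length R (N ⧸ M.submoduleOf N) = (i + j : ℕ) := by
  let q := (M.submoduleOf N).mkQ
  have hq : ∀ a b : R, a • q ⟨e, he⟩ + b • q ⟨f, hf⟩ = 0 ↔ ϖ ^ i ∣ a ∧ ϖ ^ j ∣ b := by
    intro a b
    rw [← hij, ← map_smul, ← map_smul, ← map_add]
    exact Submodule.Quotient.mk_eq_zero _
  let φ : (R ⧸ Ideal.span {ϖ ^ i}) × (R ⧸ Ideal.span {ϖ ^ j}) →ₗ[R] N ⧸ M.submoduleOf N :=
    LinearMap.coprod
      (liftQ _ (LinearMap.toSpanSingleton R _ (q ⟨e, he⟩)) (by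
        intro a ha
        have := (hq a 0).2 ⟨Ideal.mem_span_singleton.1 ha, dvd_zero _⟩
        simpa using this))
      (liftQ _ (LinearMap.toSpanSingleton R _ (q ⟨f, hf⟩)) (by
        intro a ha
        have := (hq 0 a).2 ⟨dvd_zero _, Ideal.mem_span_singleton.1 ha⟩
        simpa using this))
  have hφ : ∀ a b : R, φ (Submodule.Quotient.mk a, Submodule.Quotient.mk b) =
      a • q ⟨e, he⟩ + b • q ⟨f, hf⟩ := fun a b => rfl
  have hbij : Function.Bijective φ := by
    constructor
    · rw [injective_iff_map_eq_zero]
      rintro ⟨a, b⟩ hab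
      obtain ⟨a, rfl⟩ := Submodule.Quotient.mk_surjective _ a
      obtain ⟨b, rfl⟩ := Submodule.Quotient.mk_surjective _ b
      rw [hφ, hq] at hab
      refine Prod.ext ?_ ?_
      · exact (Submodule.Quotient.mk_eq_zero _).2 (Ideal.mem_span_singleton.2 hab.1)
      · exact (Submodule.Quotient.mk_eq_zero _).2 (Ideal.mem_span_singleton.2 hab.2)
    · intro y
      obtain ⟨⟨x, hx⟩, rfl⟩ := Submodule.mkQ_surjective _ y
      obtain ⟨z, hz, m, hm, rfl⟩ := mem_sup.1 (h hx)
      obtain ⟨a, b, rfl⟩ := mem_span_pair.1 hz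
      refine ⟨(Submodule.Quotient.mk a, Submodule.Quotient.mk b), ?_⟩
      rw [hφ, ← map_smul, ← map_smul, ← map_add]
      refine (Submodule.Quotient.eq _).2 ?_
      change (a • e + b • f) - (a • e + b • f + m) ∈ M
      simpa using hm
  rw [← (LinearEquiv.ofBijective φ hbij).length_eq, Module.length_prod,
    length_quotient_span_pow hϖ, length_quotient_span_pow hϖ, Nat.cast_add]

end Length

/-! ### The lower root as a lattice, and its comparison with the integral closure. -/

section LowerRootLattice

open Submodule

variable {R K Q : Type*} [CommRing R] [Field K] [Algebra R K]
  [CommRing Q] [Algebra K Q] [Algebra R Q] [IsScalarTower R K Q]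

variable (K) in
/-- The submodule of `A†` whose image in `B = A†/A` is the sum of the `cB ∩ B[c]`, for `c` in the
given family. -/
noncomputable def lowerRootLatticeOf {ι : Type*} (c : ι → R) (A : Subalgebra R Q) :
    Submodule R Q :=
  Subalgebra.toSubmodule A ⊔ ⨆ k : ι,
    ((traceDualSubmodule R K Q (Subalgebra.toSubmodule A)).map (LinearMap.lsmul R Q (c k)) ⊓
      (Subalgebra.toSubmodule A).comap (LinearMap.lsmul R Q (c k)))

theorem lowerRootLatticeOf_le_iff {ι : Type*} {c : ι → R} {A : Subalgebra R Q}
    {N : Submodule R Q} :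
    lowerRootLatticeOf K c A ≤ N ↔ Subalgebra.toSubmodule A ≤ N ∧
      ∀ k, ∀ y ∈ traceDualSubmodule R K Q (Subalgebra.toSubmodule A),
        c k • c k • y ∈ A → c k • y ∈ N := by
  rw [lowerRootLatticeOf, sup_le_iff, iSup_le_iff]
  refine and_congr_right fun _ => forall_congr' fun k => ⟨fun h y hy hA => ?_, fun h => ?_⟩
  · exact h ⟨⟨y, hy, rfl⟩, hA⟩
  · rintro _ ⟨⟨y, hy, rfl⟩, hA⟩
    exact h y hy hA

variable (K) in
/-- The submodule of `A†` whose image in `A†/A` is the lower root of `A†/A`. -/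
noncomputable abbrev lowerRootLattice (ϖ : R) (A : Subalgebra R Q) : Submodule R Q :=
  lowerRootLatticeOf K (fun k : ℕ => ϖ ^ k) A

theorem lowerRootLattice_le_iff {ϖ : R} {A : Subalgebra R Q} {N : Submodule R Q} :
    lowerRootLattice K ϖ A ≤ N ↔ Subalgebra.toSubmodule A ≤ N ∧
      ∀ (k : ℕ), ∀ y ∈ traceDualSubmodule R K Q (Subalgebra.toSubmodule A),
        ϖ ^ k • ϖ ^ k • y ∈ A → ϖ ^ k • y ∈ N := lowerRootLatticeOf_le_iff

theorem le_lowerRootLattice (ϖ : R) (A : Subalgebra R Q) :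
    Subalgebra.toSubmodule A ≤ lowerRootLattice K ϖ A := le_sup_left

theorem smul_mem_lowerRootLattice {ϖ : R} {A : Subalgebra R Q} {k : ℕ} {y : Q}
    (hy : y ∈ traceDualSubmodule R K Q (Subalgebra.toSubmodule A))
    (hA : ϖ ^ k • ϖ ^ k • y ∈ A) : ϖ ^ k • y ∈ lowerRootLattice K ϖ A :=
  (lowerRootLattice_le_iff.1 le_rfl).2 k y hy hA

theorem lowerRootLattice_le_traceDualSubmodule {ϖ : R} {A : Subalgebra R Q}
    (hA : Subalgebra.toSubmodule A ≤ traceDualSubmodule R K Q (Subalgebra.toSubmodule A)) :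
    lowerRootLattice K ϖ A ≤ traceDualSubmodule R K Q (Subalgebra.toSubmodule A) :=
  lowerRootLattice_le_iff.2 ⟨hA, fun _ _ hy _ => smul_mem _ _ hy⟩

/-- The lower root is isotropic. -/
theorem lowerRootLattice_isotropic {ϖ : R} {A : Subalgebra R Q}
    (hA : Subalgebra.toSubmodule A ≤ traceDualSubmodule R K Q (Subalgebra.toSubmodule A)) :
    lowerRootLattice K ϖ A ≤ traceDualSubmodule R K Q (lowerRootLattice K ϖ A) := by
  have key : ∀ k l, k ≤ l → ∀ x ∈ traceDualSubmodule R K Q (Subalgebra.toSubmodule A),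
      ∀ y ∈ traceDualSubmodule R K Q (Subalgebra.toSubmodule A),
      ϖ ^ k • ϖ ^ k • x ∈ A →
      Algebra.trace K Q ((ϖ ^ l • y) * (ϖ ^ k • x)) ∈ (algebraMap R K).range := by
    intro k l hkl x _ y hy hxA
    obtain ⟨l, rfl⟩ := Nat.exists_eq_add_of_le hkl
    -- All spare powers of `ϖ` are moved to the factor with the smaller exponent, which puts it in
    -- `A`; the other factor is in `A†`.
    have e : (ϖ ^ (k + l) • y) * (ϖ ^ k • x) = y * (ϖ ^ l • ϖ ^ k • ϖ ^ k • x) := by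
      simp only [Algebra.smul_def, map_pow]
      ring
    rw [e]
    exact hy _ (A.smul_mem hxA _)
  refine lowerRootLattice_le_iff.2 ⟨?_, fun k x hx hxA => le_traceDualSubmodule_comm
    (N := span R {ϖ ^ k • x}) (lowerRootLattice_le_iff.2 ⟨?_, fun l y hy hyA z hz => ?_⟩)
      (mem_span_singleton_self _)⟩
  · exact le_traceDualSubmodule_comm (lowerRootLattice_le_traceDualSubmodule hA)
  · refine le_traceDualSubmodule_comm ?_
    rw [span_singleton_le_iff_mem]
    exact smul_mem _ _ hx
  · obtain ⟨c, rfl⟩ := mem_span_singleton.1 hz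
    rw [mul_smul_comm, trace_smul']
    refine mem_range_smul ?_ c
    rcases le_total k l with h | h
    · exact key k l h x hx y hy hxA
    · rw [mul_comm]
      exact key l k h y hy x hx hyA

variable (K) in
/-- Generators `e`, `f` of `A†` modulo `A`, orthogonal for the trace form, of orders `ϖ^i`, `ϖ^j`. -/
structure IsOrthogonalPair (ϖ : R) (A : Subalgebra R Q) (e f : Q) (i j : ℕ) : Prop where
  left_mem : e ∈ traceDualSubmodule R K Q (Subalgebra.toSubmodule A)
  right_mem : f ∈ traceDualSubmodule R K Q (Subalgebra.toSubmodule A)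
  le_span : traceDualSubmodule R K Q (Subalgebra.toSubmodule A) ≤
    span R {e, f} ⊔ Subalgebra.toSubmodule A
  orthogonal : Algebra.trace K Q (e * f) = 0
  left_iff : ∀ a : R, a • Algebra.trace K Q (e * e) ∈ (algebraMap R K).range ↔ ϖ ^ i ∣ a
  right_iff : ∀ a : R, a • Algebra.trace K Q (f * f) ∈ (algebraMap R K).range ↔ ϖ ^ j ∣ a

theorem exists_eq_of_le_span_pair {A : Subalgebra R Q} {e f : Q}
    (h : traceDualSubmodule R K Q (Subalgebra.toSubmodule A) ≤
      span R {e, f} ⊔ Subalgebra.toSubmodule A) {x : Q}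
    (hx : x ∈ traceDualSubmodule R K Q (Subalgebra.toSubmodule A)) :
    ∃ a b : R, ∃ z ∈ A, x = a • e + b • f + z := by
  obtain ⟨y, hy, z, hz, rfl⟩ := mem_sup.1 (h hx)
  obtain ⟨a, b, rfl⟩ := mem_span_pair.1 hy
  exact ⟨a, b, z, hz, rfl⟩

namespace IsOrthogonalPair

variable {ϖ : R} {A : Subalgebra R Q} {e f : Q} {i j : ℕ}

theorem symm (h : IsOrthogonalPair K ϖ A e f i j) : IsOrthogonalPair K ϖ A f e j i :=
  ⟨h.right_mem, h.left_mem, by rw [Set.pair_comm]; exact h.le_span,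
    by rw [mul_comm]; exact h.orthogonal, h.right_iff, h.left_iff⟩

theorem trace_left (h : IsOrthogonalPair K ϖ A e f i j) (a b : R) :
    Algebra.trace K Q (e * (a • e + b • f)) = a • Algebra.trace K Q (e * e) := by
  rw [mul_add, mul_smul_comm, mul_smul_comm, map_add, trace_smul', trace_smul', h.orthogonal,
    smul_zero, add_zero]

theorem trace_right (h : IsOrthogonalPair K ϖ A e f i j) (a b : R) :
    Algebra.trace K Q (f * (a • e + b • f)) = b • Algebra.trace K Q (f * f) := by
  rw [add_comm]
  exact h.symm.trace_left b a

/-- The quadratic form on `A†/A` in the coordinates given by an orthogonal pair. -/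
theorem sq_add_sq_mem_range (h : IsOrthogonalPair K ϖ A e f i j)
    (hA : Subalgebra.toSubmodule A ≤ traceDualSubmodule R K Q (Subalgebra.toSubmodule A))
    {a b : R} {z : Q} (hz : z ∈ A)
    (hx : Algebra.trace K Q ((a • e + b • f + z) * (a • e + b • f + z)) ∈ (algebraMap R K).range) :
    a ^ 2 • Algebra.trace K Q (e * e) + b ^ 2 • Algebra.trace K Q (f * f) ∈
      (algebraMap R K).range := by
  have hy : a • e + b • f ∈ traceDualSubmodule R K Q (Subalgebra.toSubmodule A) :=
    add_mem (smul_mem _ _ h.left_mem) (smul_mem _ _ h.right_mem)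
  have e1 : (a • e + b • f + z) * (a • e + b • f + z) = (a • e + b • f) * (a • e + b • f) +
      ((a • e + b • f) * z + (a • e + b • f) * z + z * z) := by ring
  rw [e1, map_add] at hx
  have h2 : Algebra.trace K Q ((a • e + b • f) * z + (a • e + b • f) * z + z * z) ∈
      (algebraMap R K).range := by
    rw [map_add, map_add]
    exact add_mem (add_mem (hy z hz) (hy z hz)) (hA hz z hz)
  have h3 := (add_mem_cancel_right h2).1 hx
  rw [add_mul, smul_mul_assoc, smul_mul_assoc, map_add, trace_smul', trace_smul', h.trace_left,
    h.trace_right, smul_smul, smul_smul, ← pow_two a, ← pow_two b] at h3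
  exact h3

variable [IsDomain R] [IsDiscreteValuationRing R] [IsFractionRing R K]

theorem mem_of_trace_mem (h : IsOrthogonalPair K ϖ A e f i j)
    [IsLattice K (Subalgebra.toSubmodule A)] (hQ : (Algebra.traceForm K Q).Nondegenerate) {x : Q}
    (hx : x ∈ traceDualSubmodule R K Q (Subalgebra.toSubmodule A))
    (hxe : Algebra.trace K Q (e * x) ∈ (algebraMap R K).range)
    (hxf : Algebra.trace K Q (f * x) ∈ (algebraMap R K).range) : x ∈ A := by
  rw [← Subalgebra.mem_toSubmodule,
    ← traceDualSubmodule_traceDualSubmodule hQ (Subalgebra.toSubmodule A)]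
  intro y hy
  obtain ⟨a, b, z, hz, rfl⟩ := exists_eq_of_le_span_pair h.le_span hy
  rw [mul_add, mul_add, mul_smul_comm, mul_smul_comm, map_add, map_add, trace_smul', trace_smul',
    mul_comm x e, mul_comm x f]
  exact add_mem (add_mem (mem_range_smul hxe a) (mem_range_smul hxf b)) (hx z hz)

/-- Biduality `A†† = A` lets membership in `A` be tested by pairing with `e` and `f`. Thus the poles
of `(e,e)` and `(f,f)` are the orders of `e` and `f` modulo `A`, which are independent there. -/
theorem smul_add_smul_mem_iff (h : IsOrthogonalPair K ϖ A e f i j)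
    [IsLattice K (Subalgebra.toSubmodule A)] (hQ : (Algebra.traceForm K Q).Nondegenerate)
    (a b : R) : a • e + b • f ∈ A ↔ ϖ ^ i ∣ a ∧ ϖ ^ j ∣ b := by
  rw [← h.left_iff, ← h.right_iff]
  constructor
  · intro hab
    have h1 := h.left_mem _ hab
    have h2 := h.right_mem _ hab
    rw [h.trace_left] at h1
    rw [h.trace_right] at h2
    exact ⟨h1, h2⟩
  · rintro ⟨ha, hb⟩
    refine h.mem_of_trace_mem hQ
      (add_mem (smul_mem _ _ h.left_mem) (smul_mem _ _ h.right_mem)) ?_ ?_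
    · rwa [h.trace_left]
    · rwa [h.trace_right]

theorem smul_mem_lowerRootLattice (h : IsOrthogonalPair K ϖ A e f i j) (hϖ : Irreducible ϖ)
    [IsLattice K (Subalgebra.toSubmodule A)] (hQ : (Algebra.traceForm K Q).Nondegenerate)
    {a : R} (ha : a ^ 2 • Algebra.trace K Q (e * e) ∈ (algebraMap R K).range) :
    a • e ∈ lowerRootLattice K ϖ A := by
  rcases eq_or_ne a 0 with rfl | h0
  · rw [zero_smul]
    exact zero_mem _
  obtain ⟨k, u, rfl⟩ := IsDiscreteValuationRing.eq_unit_mul_pow_irreducible h0 hϖ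
  have hA : (↑u * ϖ ^ k) ^ 2 • e ∈ A := by
    have := (h.smul_add_smul_mem_iff hQ ((↑u * ϖ ^ k) ^ 2) 0).2
      ⟨(h.left_iff _).1 ha, dvd_zero _⟩
    rwa [zero_smul, add_zero] at this
  rw [mul_smul]
  refine smul_mem _ _ (_root_.smul_mem_lowerRootLattice h.left_mem ?_)
  have e1 : ϖ ^ k • ϖ ^ k • e = ((↑u⁻¹ : R) ^ 2) • ((↑u * ϖ ^ k) ^ 2 • e) := by
    rw [smul_smul, smul_smul]
    congr 1
    have hu : (↑u⁻¹ : R) * u = 1 := u.inv_mul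
    linear_combination (-(↑u⁻¹ : R) * u - 1) * ϖ ^ (2 * k) * hu
  rw [e1]
  exact A.smul_mem hA _

/-- Isotropic vectors lie in the lower root. -/
theorem mem_lowerRootLattice (h : IsOrthogonalPair K ϖ A e f i j) (hϖ : Irreducible ϖ)
    (hij : Odd (i + j) ∨ f = 0)
    [IsLattice K (Subalgebra.toSubmodule A)] (hQ : (Algebra.traceForm K Q).Nondegenerate)
    (hA : Subalgebra.toSubmodule A ≤ traceDualSubmodule R K Q (Subalgebra.toSubmodule A))
    {x : Q} (hx : x ∈ traceDualSubmodule R K Q (Subalgebra.toSubmodule A))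
    (hxx : Algebra.trace K Q (x * x) ∈ (algebraMap R K).range) :
    x ∈ lowerRootLattice K ϖ A := by
  obtain ⟨a, b, z, hz, rfl⟩ := exists_eq_of_le_span_pair h.le_span hx
  have hab := h.sq_add_sq_mem_range hA hz hxx
  refine add_mem (add_mem ?_ ?_) (le_lowerRootLattice ϖ A hz)
  · refine h.smul_mem_lowerRootLattice hϖ hQ ?_
    rcases hij with hij | rfl
    · exact sq_smul_mem_range_of_add_mem_range hϖ h.left_iff h.right_iff hij hab
    · simpa using hab
  · rcases hij with hij | rfl
    · refine h.symm.smul_mem_lowerRootLattice hϖ hQ ?_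
      rw [add_comm] at hab hij
      exact sq_smul_mem_range_of_add_mem_range hϖ h.right_iff h.left_iff hij hab
    · rw [smul_zero]
      exact zero_mem _

/-- If `i` is odd then there is no self-dual lattice. -/
theorem not_self_dual_of_odd_left (h : IsOrthogonalPair K ϖ A e f i j) (hϖ : Irreducible ϖ)
    (hi : Odd i) (hj : Even j)
    (hA : Subalgebra.toSubmodule A ≤ traceDualSubmodule R K Q (Subalgebra.toSubmodule A))
    {M : Submodule R Q} (hM : M ≤ traceDualSubmodule R K Q (Subalgebra.toSubmodule A))
    (hMM : M ≤ traceDualSubmodule R K Q M) : ¬ traceDualSubmodule R K Q M ≤ M := by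
  intro hle
  obtain ⟨n, rfl⟩ := hi
  -- With `i = 2n + 1`, isotropy of `m` gives `ϖ^(2n+1) ∣ a²`, hence `ϖ^(n+1) ∣ a`; so `ϖ^n e` pairs
  -- integrally with all of `M`. Its own square has a pole, since `2n < i`.
  have hz : ϖ ^ n • e ∈ traceDualSubmodule R K Q M := by
    intro m hm
    have hmm := hMM hm m hm
    obtain ⟨a, b, z, hz, rfl⟩ := exists_eq_of_le_span_pair h.le_span (hM hm)
    have ha := sq_smul_mem_range_of_add_mem_range hϖ h.left_iff h.right_iff
      (by rw [add_assoc, add_comm 1, ← add_assoc]; exact ((even_two_mul n).add hj).add_one)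
      (h.sq_add_sq_mem_range hA hz hmm)
    obtain ⟨c, rfl⟩ := pow_dvd_of_pow_dvd_sq hϖ ((h.left_iff _).1 ha)
    rw [smul_mul_assoc, trace_smul', mul_add, map_add, h.trace_left, smul_add, smul_smul]
    refine add_mem ?_ (mem_range_smul (h.left_mem z hz) _)
    rw [h.left_iff]
    exact ⟨c, by ring⟩
  have h2 := hz _ (hle hz)
  rw [smul_mul_assoc, mul_smul_comm, trace_smul', trace_smul', smul_smul, h.left_iff, ← pow_add,
    pow_dvd_pow_iff hϖ.ne_zero hϖ.not_isUnit] at h2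
  omega

theorem not_self_dual (h : IsOrthogonalPair K ϖ A e f i j) (hϖ : Irreducible ϖ)
    (hij : Odd (i + j))
    (hA : Subalgebra.toSubmodule A ≤ traceDualSubmodule R K Q (Subalgebra.toSubmodule A))
    {M : Submodule R Q} (hM : M ≤ traceDualSubmodule R K Q (Subalgebra.toSubmodule A))
    (hMM : M ≤ traceDualSubmodule R K Q M) : ¬ traceDualSubmodule R K Q M ≤ M := by
  rcases Nat.even_or_odd i with hi | hi
  · exact h.symm.not_self_dual_of_odd_left hϖ ((Nat.odd_add'.1 hij).2 hi) hi hA hM hMM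
  · exact h.not_self_dual_of_odd_left hϖ hi ((Nat.odd_add.1 hij).1 hi) hA hM hMM

end IsOrthogonalPair

section Core

variable [IsDomain R] [IsDiscreteValuationRing R] [IsFractionRing R K] {ϖ : R}
  {A : Subalgebra R Q}

/-- One Gram–Schmidt step: when `(e,e)` divides `(e,f)`, replacing `f` by `f - r e` makes the
generators orthogonal without changing their span. -/
theorem exists_isOrthogonalPair_of_trace_eq_smul (hϖ : Irreducible ϖ) {e f : Q}
    (he : e ∈ traceDualSubmodule R K Q (Subalgebra.toSubmodule A))
    (hf : f ∈ traceDualSubmodule R K Q (Subalgebra.toSubmodule A))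
    (hspan : traceDualSubmodule R K Q (Subalgebra.toSubmodule A) ≤
      span R {e, f} ⊔ Subalgebra.toSubmodule A)
    {r : R} (hr : Algebra.trace K Q (e * f) = r • Algebra.trace K Q (e * e)) :
    ∃ (f' : Q) (i j : ℕ), IsOrthogonalPair K ϖ A e f' i j := by
  obtain ⟨i, hi⟩ := exists_smul_mem_range_iff_pow_dvd hϖ (Algebra.trace K Q (e * e))
  obtain ⟨j, hj⟩ := exists_smul_mem_range_iff_pow_dvd hϖ
    (Algebra.trace K Q ((f - r • e) * (f - r • e)))
  refine ⟨f - r • e, i, j, he, sub_mem hf (smul_mem _ _ he), hspan.trans ?_, ?_, hi, hj⟩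
  · refine sup_le_sup_right (span_le.2 ?_) _
    rintro x (rfl | rfl)
    · exact subset_span (by simp)
    · exact mem_span_pair.2 ⟨r, 1, by simp⟩
  · rw [mul_sub, mul_smul_comm, map_sub, trace_smul', hr, sub_self]

/-- A symmetric bilinear form over a discrete valuation ring with `2` invertible can be
diagonalised. -/
theorem exists_isOrthogonalPair (hϖ : Irreducible ϖ) (h2 : IsUnit (2 : R)) {e f : Q}
    (he : e ∈ traceDualSubmodule R K Q (Subalgebra.toSubmodule A))
    (hf : f ∈ traceDualSubmodule R K Q (Subalgebra.toSubmodule A))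
    (hspan : traceDualSubmodule R K Q (Subalgebra.toSubmodule A) ≤
      span R {e, f} ⊔ Subalgebra.toSubmodule A) :
    ∃ (e' f' : Q) (i j : ℕ), IsOrthogonalPair K ϖ A e' f' i j := by
  obtain ⟨r, hr⟩ := exists_eq_smul_or_eq_smul (R := R) (Algebra.trace K Q (e * f))
    (Algebra.trace K Q (e * e))
  obtain ⟨s, hs⟩ := exists_eq_smul_or_eq_smul (R := R) (Algebra.trace K Q (e * f))
    (Algebra.trace K Q (f * f))
  have hinv : ∀ {u : R} {x y : K}, IsUnit u → x = u • y → ∃ v : R, y = v • x := by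
    rintro _ x y ⟨u, rfl⟩ rfl
    exact ⟨↑u⁻¹, by rw [smul_smul, Units.inv_mul, one_smul]⟩
  have hleft : ∀ r : R, Algebra.trace K Q (e * f) = r • Algebra.trace K Q (e * e) →
      ∃ (e' f' : Q) (i j : ℕ), IsOrthogonalPair K ϖ A e' f' i j := fun r hr =>
    ⟨e, exists_isOrthogonalPair_of_trace_eq_smul hϖ he hf hspan hr⟩
  have hright : ∀ s : R, Algebra.trace K Q (e * f) = s • Algebra.trace K Q (f * f) →
      ∃ (e' f' : Q) (i j : ℕ), IsOrthogonalPair K ϖ A e' f' i j := fun s hs =>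
    ⟨f, exists_isOrthogonalPair_of_trace_eq_smul hϖ hf he (by rwa [Set.pair_comm])
      (by rw [mul_comm f e, hs])⟩
  rcases hr with hr | hr
  · exact hleft r hr
  rcases hs with hs | hs
  · exact hright s hs
  by_cases hru : IsUnit r
  · obtain ⟨v, hv⟩ := hinv hru hr
    exact hleft v hv
  by_cases hsu : IsUnit s
  · obtain ⟨v, hv⟩ := hinv hsu hs
    exact hright v hv
  -- What remains is the case where `(e,e)` and `(f,f)` are proper multiples of `(e,f)`. Then
  -- `(e+f,e+f) = (r+s+2)(e,f)` is a unit multiple of `(e,f)`, because `2` is a unit, and `e + f`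
  -- can serve as the first vector.
  have hu : IsUnit (r + s + 2) := by
    by_contra hnu
    have h1 : r + s ∈ IsLocalRing.maximalIdeal R := Ideal.add_mem _ hru hsu
    have h3 := Ideal.sub_mem _ (show r + s + 2 ∈ IsLocalRing.maximalIdeal R from hnu) h1
    rw [add_sub_cancel_left] at h3
    exact h3 h2
  have he' : Algebra.trace K Q ((e + f) * (e + f)) = (r + s + 2) • Algebra.trace K Q (e * f) := by
    rw [show (e + f) * (e + f) = e * e + f * f + (e * f + e * f) by ring]
    simp only [map_add, hr, hs, add_smul, two_smul]
  obtain ⟨v, hv⟩ := hinv hu he'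
  refine ⟨e + f, exists_isOrthogonalPair_of_trace_eq_smul hϖ (add_mem he hf) hf
    (hspan.trans (sup_le_sup_right (span_le.2 ?_) _)) (r := (1 + s) * v) ?_⟩
  · rintro x (rfl | rfl)
    · exact mem_span_pair.2 ⟨1, -1, by simp⟩
    · exact subset_span (by simp)
  · rw [add_mul, map_add, hs, mul_smul, ← hv, add_smul, one_smul]

/-- The integral closure is the lower root. -/
theorem integralClosure_eq_lowerRootLattice_of_isOrthogonalPair (hϖ : Irreducible ϖ)
    (h2 : IsUnit (2 : R)) (hQ : (Algebra.traceForm K Q).Nondegenerate)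
    [IsLattice K (Subalgebra.toSubmodule A)] {e f : Q} {i j : ℕ}
    (h : IsOrthogonalPair K ϖ A e f i j) (hij : Odd (i + j) ∨ f = 0) :
    Subalgebra.toSubmodule (integralClosure R Q) = lowerRootLattice K ϖ A := by
  have hO := isLattice_integralClosure hQ A
  have hAO : Subalgebra.toSubmodule A ≤ Subalgebra.toSubmodule (integralClosure R Q) :=
    le_integralClosure_of_isLattice (K := K) A
  have hOO := integralClosure_le_traceDualSubmodule (K := K) A
  have hOA := traceDualSubmodule_integralClosure_le (K := K) A
  have hdd := traceDualSubmodule_traceDualSubmodule hQ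
    (Subalgebra.toSubmodule (integralClosure R Q))
  set O := integralClosure R Q with hOdef
  set O' := Subalgebra.toSubmodule O with hO'
  set D := traceDualSubmodule R K Q O' with hD
  have hA := hAO.trans (hOO.trans hOA)
  have hle : O' ≤ lowerRootLattice K ϖ A := fun x hx =>
    h.mem_lowerRootLattice hϖ hij hQ hA (hOA (hOO hx)) (hOO hx x hx)
  have hrel : HasPrimitiveRelations 3 O' D := by
    have hs := h.le_span
    rw [← Matrix.range_cons_cons_empty e f ![]] at hs
    exact (hasPrimitiveRelations_of_le_span_sup (by norm_num) _ hs).mono hAO hOA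
  have hdiv : ∀ r : R, ¬ IsUnit r → ∀ y ∈ D, r • y ∈ O' := by
    intro r hr y hy
    have hmem : r ∈ IsLocalRing.maximalIdeal R := hr
    rw [hϖ.maximalIdeal_eq, Ideal.mem_span_singleton] at hmem
    obtain ⟨c, rfl⟩ := hmem
    rw [mul_comm, mul_smul]
    exact smul_mem _ _ (smul_mem_integralClosure_of_mem_traceDualSubmodule hϖ h2 hrel hy)
  have hunit : ∀ r : R, IsUnit r → ∀ N : Submodule R Q, ∀ y, r • y ∈ N → y ∈ N := by
    rintro _ ⟨u, rfl⟩ N y hy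
    have := N.smul_mem (↑u⁻¹ : R) hy
    rwa [smul_smul, Units.inv_mul, one_smul] at this
  have hunitK : ∀ r : R, IsUnit r → ∀ z : K, r • z ∈ (algebraMap R K).range →
      z ∈ (algebraMap R K).range := by
    rintro _ ⟨u, rfl⟩ z hz
    have := mem_range_smul hz (↑u⁻¹ : R)
    rwa [smul_smul, Units.inv_mul, one_smul] at this
  refine le_antisymm hle fun x hx => ?_
  -- The lower root is isotropic and contains `O`, so it lies in `O† = D`.
  have hxD : x ∈ D := traceDualSubmodule_anti hle (lowerRootLattice_isotropic hA hx)
  have hxx : Algebra.trace K Q (x * x) ∈ (algebraMap R K).range :=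
    lowerRootLattice_isotropic hA hx x hx
  by_contra hcon
  obtain ⟨y, hyD, hxy⟩ : ∃ y ∈ D, Algebra.trace K Q (x * y) ∉ (algebraMap R K).range := by
    by_contra! hall
    exact hcon (hdd ▸ (show x ∈ traceDualSubmodule R K Q D from hall))
  rcases hij with hij | rfl
  -- In `D/O`, of dimension at most two, the isotropic line spanned by `x` would be its own
  -- orthogonal complement.
  · refine h.not_self_dual hϖ hij hA (M := O' ⊔ span R {x})
      (sup_le (hOO.trans hOA) (span_le.2 ?_)) ?_ ?_
    · rintro _ rfl
      exact hOA hxD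
    · have hxspan : span R {x} ≤ D := by
        rwa [span_singleton_le_iff_mem]
      refine sup_le ?_ ?_
      · refine le_traceDualSubmodule_comm (sup_le hOO hxspan)
      · refine le_traceDualSubmodule_comm (sup_le (le_traceDualSubmodule_comm hxspan) ?_)
        rw [span_singleton_le_iff_mem]
        intro z hz
        obtain ⟨c, rfl⟩ := mem_span_singleton.1 hz
        rw [mul_smul_comm, trace_smul']
        exact mem_range_smul hxx c
    · intro z hz
      have hzD : z ∈ D := traceDualSubmodule_anti le_sup_left hz
      have hxz : Algebra.trace K Q (x * z) ∈ (algebraMap R K).range := by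
        rw [mul_comm]
        exact hz x (mem_sup_right (mem_span_singleton_self x))
      obtain ⟨r, hr, hsum⟩ := hrel ![x, y, z] (by
        intro i; fin_cases i
        · exact hxD
        · exact hyD
        · exact hzD)
      simp only [Fin.sum_univ_three, Matrix.cons_val] at hsum
      -- Pairing the relation with `x` removes all but the term in `y`, and `(x,y)` is not integral.
      have h1 : ¬ IsUnit (r 1) := by
        intro hu
        refine hxy (hunitK _ hu _ ?_)
        have ht := hxD _ hsum
        simp only [mul_add, mul_smul_comm, map_add, trace_smul'] at ht
        rw [add_mem_cancel_right (mem_range_smul hxz _)] at ht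
        exact (add_mem_cancel_left (mem_range_smul hxx _)).1 ht
      by_cases h2 : IsUnit (r 2)
      · refine hunit _ h2 _ _ ?_
        have hsum' : r 0 • x + r 1 • y + r 2 • z ∈ O' ⊔ span R {x} := mem_sup_left hsum
        refine (add_mem_cancel_left (add_mem ?_ ?_)).1 hsum'
        · exact mem_sup_right (smul_mem _ _ (mem_span_singleton_self x))
        · exact mem_sup_left (hdiv _ h1 y hyD)
      · have h0 : IsUnit (r 0) := by
          obtain ⟨i, hi⟩ := hr
          fin_cases i
          · exact hi
          · contradiction
          · contradiction
        refine absurd (hunit _ h0 O' x ?_) hcon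
        rw [add_mem_cancel_right (hdiv _ h2 z hzD), add_mem_cancel_right (hdiv _ h1 y hyD)] at hsum
        exact hsum
  -- In the cyclic case `D/O` has dimension at most one, so `x` and `y` are proportional there,
  -- contradicting that `(x,x)` is integral while `(x,y)` is not.
  · have hrel2 : HasPrimitiveRelations 2 O' D := by
      have hs := h.le_span
      rw [show span R ({e, 0} : Set Q) = span R (Set.range ![e]) by
        rw [Set.pair_comm, span_insert_zero]; simp] at hs
      exact (hasPrimitiveRelations_of_le_span_sup (by norm_num) _ hs).mono hAO hOA
    obtain ⟨r, hr, hsum⟩ := hrel2 ![x, y] (by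
      intro i; fin_cases i
      · exact hxD
      · exact hyD)
    simp only [Fin.sum_univ_two, Matrix.cons_val_zero, Matrix.cons_val_one] at hsum
    have h1 : ¬ IsUnit (r 1) := by
      intro hu
      refine hxy (hunitK _ hu _ ?_)
      have ht := hxD _ hsum
      simp only [mul_add, mul_smul_comm, map_add, trace_smul'] at ht
      exact (add_mem_cancel_left (mem_range_smul hxx _)).1 ht
    have h0 : IsUnit (r 0) := by
      obtain ⟨i, hi⟩ := hr
      fin_cases i
      · exact hi
      · contradiction
    rw [add_mem_cancel_right (hdiv _ h1 y hyD)] at hsum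
    exact hcon (hunit _ h0 O' x hsum)

/-- The integral closure is the lower root if `A†/A` is cyclic. -/
theorem integralClosure_eq_lowerRootLattice_of_cyclic (hϖ : Irreducible ϖ)
    (h2 : IsUnit (2 : R)) (hQ : (Algebra.traceForm K Q).Nondegenerate)
    [IsLattice K (Subalgebra.toSubmodule A)] {e : Q}
    (he : e ∈ traceDualSubmodule R K Q (Subalgebra.toSubmodule A))
    (hspan : traceDualSubmodule R K Q (Subalgebra.toSubmodule A) ≤
      span R {e} ⊔ Subalgebra.toSubmodule A) :
    Subalgebra.toSubmodule (integralClosure R Q) = lowerRootLattice K ϖ A := by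
  obtain ⟨i, hi⟩ := exists_smul_mem_range_iff_pow_dvd hϖ (Algebra.trace K Q (e * e))
  obtain ⟨j, hj⟩ := exists_smul_mem_range_iff_pow_dvd hϖ (Algebra.trace K Q ((0 : Q) * 0))
  refine integralClosure_eq_lowerRootLattice_of_isOrthogonalPair hϖ h2 hQ (e := e) (f := 0)
    (i := i) (j := j) ⟨he, zero_mem _, ?_, by simp, hi, hj⟩ (Or.inr rfl)
  rwa [Set.pair_comm, span_insert_zero]

/-- The integral closure is the lower root if `A†/A` has two generators and odd length. -/
theorem integralClosure_eq_lowerRootLattice_of_odd (hϖ : Irreducible ϖ)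
    (h2 : IsUnit (2 : R)) (hQ : (Algebra.traceForm K Q).Nondegenerate)
    [IsLattice K (Subalgebra.toSubmodule A)] {e f : Q}
    (he : e ∈ traceDualSubmodule R K Q (Subalgebra.toSubmodule A))
    (hf : f ∈ traceDualSubmodule R K Q (Subalgebra.toSubmodule A))
    (hspan : traceDualSubmodule R K Q (Subalgebra.toSubmodule A) ≤
      span R {e, f} ⊔ Subalgebra.toSubmodule A) {l : ℕ} (hl : Odd l)
    (hlength : Module.length R (traceDualSubmodule R K Q (Subalgebra.toSubmodule A) ⧸
      (Subalgebra.toSubmodule A).submoduleOf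
        (traceDualSubmodule R K Q (Subalgebra.toSubmodule A))) = l) :
    Subalgebra.toSubmodule (integralClosure R Q) = lowerRootLattice K ϖ A := by
  obtain ⟨e', f', i, j, h⟩ := exists_isOrthogonalPair hϖ h2 he hf hspan
  refine integralClosure_eq_lowerRootLattice_of_isOrthogonalPair hϖ h2 hQ h (Or.inl ?_)
  rw [length_quotient_of_generators hϖ h.left_mem h.right_mem h.le_span
    (h.smul_add_smul_mem_iff hQ)] at hlength
  rwa [show i + j = l by exact_mod_cast hlength]

end Core

end LowerRootLattice

/-! ### From subalgebras of `Q` to abstract orders and their quotients. -/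

section Order

open Submodule

variable (R A K Q : Type*) [CommRing R] [CommRing A] [Algebra R A] [Field K] [Algebra R K]
  [CommRing Q] [Algebra A Q] [Algebra K Q] [Algebra R Q] [IsScalarTower R A Q] [IsScalarTower R K Q]

/-- The image of `A` in `Q`, as an `R`-subalgebra. -/
def orderSubalgebra : Subalgebra R Q := (IsScalarTower.toAlgHom R A Q).range

theorem toSubmodule_orderSubalgebra :
    Subalgebra.toSubmodule (orderSubalgebra R A Q) = orderSubmodule R A Q := rfl

variable {R A K Q}

theorem orderClosure_eq [Algebra.IsIntegral R A] :
    orderClosure R A Q = Subalgebra.toSubmodule (integralClosure R Q) := by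
  ext x
  exact ⟨fun h => isIntegral_trans (R := R) (A := A) x h, fun h => IsIntegral.tower_top h⟩

theorem quotientSubmodule_lowerRootLatticeOf {ι : Type*} (c : ι → R)
    (hA : orderSubmodule R A Q ≤ orderDual R A K Q) :
    quotientSubmodule R A K Q (lowerRootLatticeOf K c (orderSubalgebra R A Q)) =
      ⨆ k, LinearMap.range (LinearMap.lsmul R (DualQuotient R A K Q) (c k)) ⊓
        torsionBy R (DualQuotient R A K Q) (c k) := by
  apply le_antisymm
  · rintro _ ⟨⟨x, hxD⟩, hx, rfl⟩
    set L := ⨆ k, LinearMap.range (LinearMap.lsmul R (DualQuotient R A K Q) (c k)) ⊓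
        torsionBy R (DualQuotient R A K Q) (c k) with hL
    set q := ((orderSubmodule R A Q).submoduleOf (orderDual R A K Q)).mkQ with hq
    have hle : lowerRootLatticeOf K c (orderSubalgebra R A Q) ≤
        (L.comap q).map (orderDual R A K Q).subtype := by
      refine lowerRootLatticeOf_le_iff.2 ⟨fun a ha => ⟨⟨a, hA ha⟩, ?_, rfl⟩,
        fun k y hy hyA => ⟨⟨c k • y, smul_mem _ _ hy⟩, ?_, rfl⟩⟩
      · have : q ⟨a, hA ha⟩ = 0 := (Submodule.Quotient.mk_eq_zero _).2 ha
        change q ⟨a, hA ha⟩ ∈ L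
        rw [this]
        exact zero_mem _
      · refine mem_iSup_of_mem k ⟨⟨q ⟨y, hy⟩, rfl⟩, ?_⟩
        exact (Submodule.Quotient.mk_eq_zero _).2 hyA
    obtain ⟨d, hd, hdx⟩ := hle hx
    obtain rfl : d = ⟨x, hxD⟩ := Subtype.ext hdx
    exact hd
  · refine iSup_le fun k => ?_
    rintro _ ⟨⟨z, rfl⟩, hz⟩
    obtain ⟨⟨y, hy⟩, rfl⟩ := mkQ_surjective _ z
    refine ⟨c k • ⟨y, hy⟩, ?_, rfl⟩
    refine (lowerRootLatticeOf_le_iff.1 le_rfl).2 k y hy ?_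
    exact (Submodule.Quotient.mk_eq_zero _).1 hz

theorem closureQuotientEq_of_eq [Algebra.IsIntegral R A] {ι : Type*} (c : ι → R)
    (hA : orderSubmodule R A Q ≤ Subalgebra.toSubmodule (integralClosure R Q))
    (hO : Subalgebra.toSubmodule (integralClosure R Q) ≤ orderDual R A K Q)
    (h : Subalgebra.toSubmodule (integralClosure R Q) =
      lowerRootLatticeOf K c (orderSubalgebra R A Q)) :
    ClosureQuotientEq R A K Q
      (⨆ k, LinearMap.range (LinearMap.lsmul R (DualQuotient R A K Q) (c k)) ⊓
        torsionBy R (DualQuotient R A K Q) (c k)) := by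
  refine ⟨?_, ?_, ?_⟩
  · rwa [orderClosure_eq]
  · rwa [orderClosure_eq]
  · rw [orderClosure_eq, h, quotientSubmodule_lowerRootLatticeOf c (hA.trans hO)]

theorem lowerRoot_eq {M : Type*} [IsDomain R] [IsDiscreteValuationRing R] [AddCommGroup M]
    [Module R M] {ϖ : R} (hϖ : Irreducible ϖ) :
    lowerRoot R M = ⨆ k : ℕ, LinearMap.range (LinearMap.lsmul R M (ϖ ^ k)) ⊓
      torsionBy R M (ϖ ^ k) := by
  rw [lowerRoot]
  congr! 3 with k
  · rw [hϖ.maximalIdeal_eq, Ideal.span_singleton_pow, ideal_span_singleton_smul]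
    ext x
    simp [mem_smul_pointwise_iff_exists]
  · rw [hϖ.maximalIdeal_eq, Ideal.span_singleton_pow, torsionBySet_span_singleton_eq]

variable [IsFractionRing A Q]

theorem isLattice_orderSubmodule [IsDomain R] [IsFractionRing R K] [Module.Finite R A] :
    IsLattice K (Subalgebra.toSubmodule (orderSubalgebra R A Q)) := by
  refine ⟨?_, ?_⟩
  · rw [toSubmodule_orderSubalgebra, orderSubmodule, ← Submodule.map_top]
    exact Module.Finite.fg_top.map _
  · rw [eq_top_iff]
    rintro x -
    obtain ⟨a, b, rfl⟩ := IsLocalization.exists_mk'_eq (nonZeroDivisors A) x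
    -- A regular `b` integral over `R` admits a nonzero `r` in `R` with `r a` divisible by `b`, so
    -- denominators in `Q` may be taken in `R`.
    obtain ⟨d, r, hr, h⟩ := (Algebra.IsIntegral.isIntegral (R := R)
      (b : A)).isAlgebraic.exists_smul_eq_mul a b.2
    have hrK : algebraMap R K r ≠ 0 := by simpa using hr
    have e : IsLocalization.mk' Q a b = (algebraMap R K r)⁻¹ • algebraMap A Q d := by
      rw [IsLocalization.mk'_eq_iff_eq_mul, smul_mul_assoc, ← map_mul, mul_comm d, ← h,
        Algebra.smul_def r a, map_mul, ← IsScalarTower.algebraMap_apply R A Q,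
        ← Algebra.smul_def, ← IsScalarTower.algebraMap_smul K r, smul_smul, inv_mul_cancel₀ hrK,
        one_smul]
    rw [e]
    exact smul_mem _ _ (subset_span ⟨d, rfl⟩)

theorem isUnit_two_of_ringChar_ne [IsLocalRing R]
    (h : ringChar (IsLocalRing.ResidueField R) ≠ 2) : IsUnit (2 : R) := by
  by_contra h2
  have : (2 : R) ∈ IsLocalRing.maximalIdeal R := h2
  rw [← IsLocalRing.residue_eq_zero_iff, map_ofNat] at this
  have hdvd : ringChar (IsLocalRing.ResidueField R) ∣ 2 := ringChar.dvd (by exact_mod_cast this)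
  exact ((Nat.dvd_prime Nat.prime_two).1 hdvd).elim CharP.ringChar_ne_one h

end Order

theorem closureQuotientEq_lowerRoot (R A K Q : Type*) [CommRing R] [IsDomain R]
    [IsDiscreteValuationRing R] [CommRing A] [Algebra R A] [Field K] [Algebra R K]
    [IsFractionRing R K] [CommRing Q] [Algebra A Q] [IsFractionRing A Q] [Algebra K Q]
    [Algebra R Q] [IsScalarTower R A Q] [IsScalarTower R K Q] (h : IsOrderOver R A K Q)
    (hchar : ringChar (IsLocalRing.ResidueField R) ≠ 2)
    (hgen : (∃ x : DualQuotient R A K Q, Submodule.span R {x} = ⊤) ∨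
      ((∃ x y : DualQuotient R A K Q, Submodule.span R {x, y} = ⊤) ∧
        ∃ l : ℕ, Odd l ∧ Module.length R (DualQuotient R A K Q) = l)) :
    ClosureQuotientEq R A K Q (lowerRoot R (DualQuotient R A K Q)) := by
  obtain ⟨ϖ, hϖ⟩ := IsDiscreteValuationRing.exists_irreducible R
  have := h.finite
  have hQ := h.etale.2
  have hlat := isLattice_orderSubmodule (R := R) (A := A) (K := K) (Q := Q)
  have h2 := isUnit_two_of_ringChar_ne hchar
  have hspan : ∀ s : Set (DualQuotient R A K Q), Submodule.span R s = ⊤ →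
      ∀ t : Set (orderDual R A K Q), s = ((orderSubmodule R A Q).submoduleOf (orderDual R A K Q)).mkQ '' t → orderDual R A K Q ≤
      Submodule.span R (Subtype.val '' t) ⊔ orderSubmodule R A Q := by
    rintro _ hs t rfl x hx
    have : ((orderSubmodule R A Q).submoduleOf (orderDual R A K Q)).mkQ ⟨x, hx⟩ ∈
        Submodule.span R (((orderSubmodule R A Q).submoduleOf (orderDual R A K Q)).mkQ '' t) := by
      rw [hs]; trivial
    rw [← Submodule.map_span] at this
    obtain ⟨y, hy, hyx⟩ := this
    have hsub := (Submodule.Quotient.eq _).1 hyx.symm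
    rw [← add_sub_cancel (y : Q) x]
    refine add_mem (Submodule.mem_sup_left ?_) (Submodule.mem_sup_right hsub)
    have := Submodule.mem_map_of_mem (f := (orderDual R A K Q).subtype) hy
    rwa [Submodule.map_span] at this
  rw [lowerRoot_eq hϖ]
  have hAO := le_integralClosure_of_isLattice (K := K) (orderSubalgebra R A Q)
  have hOD := (integralClosure_le_traceDualSubmodule (K := K) (orderSubalgebra R A Q)).trans
    (traceDualSubmodule_integralClosure_le (K := K) (orderSubalgebra R A Q))
  refine closureQuotientEq_of_eq _ hAO hOD ?_
  rcases hgen with ⟨x, hx⟩ | ⟨⟨x, y, hxy⟩, l, hl, hlen⟩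
  · obtain ⟨⟨e, he⟩, rfl⟩ := Submodule.mkQ_surjective _ x
    refine integralClosure_eq_lowerRootLattice_of_cyclic hϖ h2 hQ he ?_
    have := hspan _ hx {⟨e, he⟩} (by simp)
    rwa [Set.image_singleton] at this
  · obtain ⟨⟨e, he⟩, rfl⟩ := Submodule.mkQ_surjective _ x
    obtain ⟨⟨f, hf⟩, rfl⟩ := Submodule.mkQ_surjective _ y
    refine integralClosure_eq_lowerRootLattice_of_odd hϖ h2 hQ he hf ?_ hl hlen
    have := hspan _ hxy {⟨e, he⟩, ⟨f, hf⟩} (by rw [Set.image_pair])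
    rwa [Set.image_pair] at this

/-! ### Localization of lattices, trace duals and lower roots at a prime. -/

section LocalizationAtPrime

open Submodule

variable {Z R K Q : Type*} [CommRing Z] (P : Ideal Z) [P.IsPrime] [CommRing R]
  [Algebra Z R] [IsLocalization.AtPrime R P] [Field K] [Algebra Z K] [Algebra R K]
  [IsScalarTower Z R K] [CommRing Q] [Algebra K Q] [Algebra R Q] [Algebra Z Q]
  [IsScalarTower Z K Q] [IsScalarTower R K Q] [IsScalarTower Z R Q]

theorem exists_smul_eq_algebraMap_smul {M : Type*} [AddCommGroup M] [Module R M] [Module Z M]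
    [IsScalarTower Z R M] (r : R) : ∃ s ∉ P, ∃ a : Z, ∀ x : M, s • r • x = a • x := by
  obtain ⟨a, s, rfl⟩ := IsLocalization.exists_mk'_eq P.primeCompl r
  refine ⟨s, s.2, a, fun x => ?_⟩
  rw [← IsScalarTower.algebraMap_smul R (s : Z), smul_smul, mul_comm, IsLocalization.mk'_spec,
    IsScalarTower.algebraMap_smul]

theorem mul_notMem_of_isPrime {s t : Z} (hs : s ∉ P) (ht : t ∉ P) : s * t ∉ P := fun h =>
  (‹P.IsPrime›.mem_or_mem h).elim hs ht

variable (R) in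
/-- The localization at a prime ideal of a submodule. -/
def localizedAtPrime (M : Submodule Z Q) : Submodule R Q where
  carrier := {x | ∃ s ∉ P, s • x ∈ M}
  zero_mem' := ⟨1, P.one_notMem, by simp⟩
  add_mem' := by
    rintro x y ⟨s, hs, hx⟩ ⟨t, ht, hy⟩
    refine ⟨s * t, mul_notMem_of_isPrime P hs ht, ?_⟩
    rw [smul_add, mul_comm, mul_smul, mul_comm, mul_smul]
    exact M.add_mem (M.smul_mem _ hx) (M.smul_mem _ hy)
  smul_mem' := by
    rintro r x ⟨s, hs, hx⟩
    obtain ⟨t, ht, a, ha⟩ := exists_smul_eq_algebraMap_smul (R := R) (M := Q) P r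
    refine ⟨s * t, mul_notMem_of_isPrime P hs ht, ?_⟩
    rw [mul_smul, ha, smul_comm]
    exact M.smul_mem _ hx

variable {P}

theorem mem_localizedAtPrime {M : Submodule Z Q} {x : Q} :
    x ∈ localizedAtPrime R P M ↔ ∃ s ∉ P, s • x ∈ M := Iff.rfl

theorem mem_localizedAtPrime_of_mem {M : Submodule Z Q} {x : Q} (hx : x ∈ M) :
    x ∈ localizedAtPrime R P M := ⟨1, P.one_notMem, by rwa [one_smul]⟩

theorem exists_smul_eq_of_notMem {M : Type*} [AddCommGroup M] [Module R M] [Module Z M]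
    [IsScalarTower Z R M] {s : Z} (hs : s ∉ P) : ∃ r : R, ∀ x : M, r • s • x = x := by
  refine ⟨IsLocalization.mk' R 1 (⟨s, hs⟩ : P.primeCompl), fun x => ?_⟩
  have h := IsLocalization.mk'_spec R (1 : Z) (⟨s, hs⟩ : P.primeCompl)
  rw [map_one] at h
  rw [← IsScalarTower.algebraMap_smul R s, smul_smul, h, one_smul]

theorem localizedAtPrime_eq_span (M : Submodule Z Q) :
    localizedAtPrime R P M = span R (M : Set Q) := by
  refine le_antisymm ?_ (span_le.2 fun x hx => mem_localizedAtPrime_of_mem hx)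
  rintro x ⟨s, hs, hx⟩
  obtain ⟨r, hr⟩ := exists_smul_eq_of_notMem (R := R) (M := Q) hs
  rw [← hr x]
  exact smul_mem _ _ (subset_span hx)

theorem isLattice_localizedAtPrime (M : Submodule Z Q) [IsLattice K M] :
    IsLattice K (localizedAtPrime R P M) := by
  refine ⟨?_, ?_⟩
  · obtain ⟨S, hS⟩ := IsLattice.fg (A := K) (M := M)
    rw [localizedAtPrime_eq_span, ← hS, span_span_of_tower]
    exact fg_span S.finite_toSet
  · rw [eq_top_iff, ← IsLattice.span_eq_top (A := K) (M := M)]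
    exact span_mono fun x hx => mem_localizedAtPrime_of_mem hx

theorem mem_range_algebraMap_iff {k : K} :
    k ∈ (algebraMap R K).range ↔ ∃ s ∉ P, s • k ∈ (algebraMap Z K).range := by
  constructor
  · rintro ⟨r, rfl⟩
    obtain ⟨s, hs, a, ha⟩ := exists_smul_eq_algebraMap_smul (R := R) (M := K) P r
    refine ⟨s, hs, a, ?_⟩
    rw [Algebra.algebraMap_eq_smul_one, Algebra.algebraMap_eq_smul_one, ha]
  · rintro ⟨s, hs, a, ha⟩
    obtain ⟨r, hr⟩ := exists_smul_eq_of_notMem (R := R) (M := K) hs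
    rw [← hr k, ← ha, IsScalarTower.algebraMap_apply Z R K]
    exact mem_range_smul ⟨_, rfl⟩ r

/-- Localization commutes with the trace dual. -/
theorem traceDualSubmodule_localizedAtPrime {M : Submodule Z Q} (hM : M.FG) :
    traceDualSubmodule R K Q (localizedAtPrime R P M) =
      localizedAtPrime R P (traceDualSubmodule Z K Q M) := by
  apply le_antisymm
  · intro x hx
    obtain ⟨S, rfl⟩ := hM
    -- Finite generation of `M` is what allows one common denominator `s` for all the pairings.
    have hS : ∃ s ∉ P, ∀ y ∈ S, s • Algebra.trace K Q (x * y) ∈ (algebraMap Z K).range := by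
      have hS' : ∀ y ∈ S, y ∈ span Z (S : Set Q) := fun y hy => subset_span hy
      generalize hN : span Z (S : Set Q) = N at hx hS'
      clear hN
      induction S using Finset.cons_induction with
      | empty => exact ⟨1, P.one_notMem, by simp⟩
      | cons y S hy ih =>
        obtain ⟨s, hs, hsS⟩ := ih fun y hy => hS' y (Finset.mem_cons_of_mem hy)
        obtain ⟨t, ht, hty⟩ := (mem_range_algebraMap_iff (P := P)).1
          (hx y (mem_localizedAtPrime_of_mem (hS' y (Finset.mem_cons_self y S))))
        refine ⟨s * t, mul_notMem_of_isPrime P hs ht, fun z hz => ?_⟩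
        rcases Finset.mem_cons.1 hz with rfl | hz
        · rw [mul_smul]
          exact mem_range_smul hty s
        · rw [mul_comm, mul_smul]
          exact mem_range_smul (hsS z hz) t
    obtain ⟨s, hs, hsS⟩ := hS
    refine ⟨s, hs, fun y hy => ?_⟩
    rw [smul_mul_assoc, trace_smul']
    induction hy using span_induction with
    | mem y hy => exact hsS y hy
    | zero => simp
    | add y z _ _ hy hz =>
      rw [mul_add, map_add, smul_add]
      exact add_mem hy hz
    | smul c y _ hy =>
      rw [mul_smul_comm, trace_smul', smul_comm]
      exact mem_range_smul hy c
  · rintro x ⟨s, hs, hx⟩ y ⟨t, ht, hy⟩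
    refine (mem_range_algebraMap_iff (P := P)).2 ⟨s * t, mul_notMem_of_isPrime P hs ht, ?_⟩
    have := hx _ hy
    rwa [smul_mul_smul_comm, trace_smul'] at this

variable (R P) in
/-- The localization at a prime ideal of a subalgebra. -/
def Subalgebra.localizedAtPrime (A : Subalgebra Z Q) : Subalgebra R Q where
  __ := _root_.localizedAtPrime R P (Subalgebra.toSubmodule A)
  mul_mem' := by
    rintro x y ⟨s, hs, hx⟩ ⟨t, ht, hy⟩
    refine ⟨s * t, mul_notMem_of_isPrime P hs ht, ?_⟩
    rw [← smul_mul_smul_comm]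
    exact A.mul_mem hx hy
  algebraMap_mem' r := by
    rw [Algebra.algebraMap_eq_smul_one]
    exact (_root_.localizedAtPrime R P (Subalgebra.toSubmodule A)).smul_mem r
      (mem_localizedAtPrime_of_mem A.one_mem)

section Prime

variable {p : Z} {A : Subalgebra Z Q}

theorem traceDualSubmodule_subalgebra_localizedAtPrime (hA : (Subalgebra.toSubmodule A).FG) :
    traceDualSubmodule R K Q (Subalgebra.toSubmodule (A.localizedAtPrime R P)) =
      localizedAtPrime R P (traceDualSubmodule Z K Q (Subalgebra.toSubmodule A)) :=
  traceDualSubmodule_localizedAtPrime hA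

theorem lowerRootLattice_localizedAtPrime_le (hA : (Subalgebra.toSubmodule A).FG) :
    lowerRootLattice K (algebraMap Z R p) (A.localizedAtPrime R P) ≤
      localizedAtPrime R P (lowerRootLatticeOf K (id : Z → Z) A) := by
  have hpow : ∀ (k : ℕ) (x : Q), algebraMap Z R p ^ k • x = p ^ k • x := fun k x => by
    rw [← map_pow, IsScalarTower.algebraMap_smul]
  refine lowerRootLattice_le_iff.2 ⟨?_, fun k y hy hyA => ?_⟩
  · rintro x ⟨s, hs, hx⟩
    exact ⟨s, hs, (lowerRootLatticeOf_le_iff.1 le_rfl).1 hx⟩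
  · rw [traceDualSubmodule_subalgebra_localizedAtPrime hA] at hy
    obtain ⟨s, hs, hy⟩ := hy
    obtain ⟨t, ht, hyA⟩ := hyA
    refine ⟨s * t, mul_notMem_of_isPrime P hs ht, ?_⟩
    -- The denominators `s` of `y` and `t` of `ϖ^{2k} y` are absorbed into `y`, leaving the exponent
    -- of `p` unchanged.
    have := (lowerRootLatticeOf_le_iff.1 (le_refl (lowerRootLatticeOf K (id : Z → Z) A))).2 (p ^ k)
      ((t * s) • y) (by rw [mul_smul]; exact smul_mem _ _ hy) ?_
    · rw [hpow, smul_comm, mul_comm s t]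
      exact this
    · have h2 := A.smul_mem hyA s
      rw [hpow, hpow] at h2
      convert h2 using 1
      simp only [id, smul_smul]
      congr 1
      ring

theorem lowerRootLatticeOf_le_localizedAtPrime [IsDomain Z] [WfDvdMonoid Z] (hp : Prime p)
    (hP : P = Ideal.span {p}) (hA : (Subalgebra.toSubmodule A).FG) :
    lowerRootLatticeOf K (id : Z → Z) A ≤
      (lowerRootLattice K (algebraMap Z R p) (A.localizedAtPrime R P)).restrictScalars Z := by
  have hpow : ∀ (k : ℕ) (x : Q), algebraMap Z R p ^ k • x = p ^ k • x := fun k x => by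
    rw [← map_pow, IsScalarTower.algebraMap_smul]
  refine lowerRootLatticeOf_le_iff.2 ⟨fun x hx => ?_, fun r y hy hyA => ?_⟩
  · exact le_lowerRootLattice _ _ (mem_localizedAtPrime_of_mem hx)
  · rcases eq_or_ne r 0 with rfl | hr
    · simp
    -- Only the `p`-part of `r` matters locally: the cofactor `c` is moved into the dual vector and
    -- inverted in `R`.
    obtain ⟨k, c, hc, rfl⟩ := WfDvdMonoid.max_power_factor hr hp.irreducible
    have hcP : c ∉ P := by rwa [hP, Ideal.mem_span_singleton]
    have := smul_mem_lowerRootLattice (K := K) (ϖ := algebraMap Z R p)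
      (A := A.localizedAtPrime R P) (k := k) (y := c • y) ?_ ?_
    · rw [hpow, smul_smul] at this
      exact this
    · rw [traceDualSubmodule_subalgebra_localizedAtPrime hA]
      exact mem_localizedAtPrime_of_mem (smul_mem _ c hy)
    · refine ⟨c, hcP, ?_⟩
      change _ ∈ A
      convert hyA using 1
      rw [hpow, hpow]
      simp only [id, smul_smul]
      congr 1
      ring

theorem pow_dvd_mk'_iff [IsDomain Z] (hp : Prime p) (hP : P = Ideal.span {p}) (n : ℕ) (a : Z)
    (s : P.primeCompl) : algebraMap Z R p ^ n ∣ IsLocalization.mk' R a s ↔ p ^ n ∣ a := by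
  constructor
  · rintro ⟨r, hr⟩
    obtain ⟨b, t, rfl⟩ := IsLocalization.exists_mk'_eq P.primeCompl r
    rw [← map_pow, IsLocalization.mul_mk'_eq_mk'_of_mul, IsLocalization.eq] at hr
    obtain ⟨c, hc⟩ := hr
    have hct : ¬ p ∣ (c * t : Z) := by
      rw [← Ideal.mem_span_singleton, ← hP]
      exact mul_notMem_of_isPrime P c.2 t.2
    refine hp.pow_dvd_of_dvd_mul_left n hct ⟨c * s * b, ?_⟩
    linear_combination hc
  · rintro ⟨b, rfl⟩
    rw [← IsLocalization.mul_mk'_eq_mk'_of_mul, map_pow]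
    exact dvd_mul_right _ _

theorem exists_mul_dvd_iff [IsDomain Z] (hp : Prime p) (hP : P = Ideal.span {p}) {i j : ℕ}
    {m m' : Z} (hm : ¬ p ∣ m) (hm' : ¬ p ∣ m') (a b : Z) :
    (∃ t ∉ P, p ^ i * m ∣ t * a ∧ p ^ j * m' ∣ t * b) ↔ p ^ i ∣ a ∧ p ^ j ∣ b := by
  simp only [hP, Ideal.mem_span_singleton]
  constructor
  · rintro ⟨t, ht, ha, hb⟩
    exact ⟨hp.pow_dvd_of_dvd_mul_left i ht ((dvd_mul_right _ _).trans ha),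
      hp.pow_dvd_of_dvd_mul_left j ht ((dvd_mul_right _ _).trans hb)⟩
  · rintro ⟨ha, hb⟩
    -- The product of the prime-to-`p` cofactors is a denominator outside `P` that serves both
    -- coordinates.
    refine ⟨m * m', fun h => (hp.dvd_or_dvd h).elim hm hm', ?_, ?_⟩
    · rw [mul_comm m m', mul_assoc, mul_comm (p ^ i)]
      exact (mul_dvd_mul_left m ha).mul_left m'
    · rw [mul_assoc, mul_comm (p ^ j)]
      exact (mul_dvd_mul_left m' hb).mul_left m

end Prime

end LocalizationAtPrime

/-! ### The local theorem applied to a localized order. -/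

section LocalGlobal

open Submodule

variable {Z R K Q : Type*} [CommRing Z] [IsDomain Z] [IsPrincipalIdealRing Z] {P : Ideal Z}
  [P.IsPrime] [CommRing R] [IsDomain R] [IsDiscreteValuationRing R]
  [Algebra Z R] [IsLocalization.AtPrime R P] [Field K] [Algebra Z K] [IsFractionRing Z K]
  [Algebra R K] [IsFractionRing R K]
  [IsScalarTower Z R K] [CommRing Q] [Algebra K Q] [Algebra R Q] [Algebra Z Q]
  [IsScalarTower Z K Q] [IsScalarTower R K Q] [IsScalarTower Z R Q] {p : Z} {A : Subalgebra Z Q}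

theorem irreducible_algebraMap_of_eq_span (hP : P = Ideal.span {p}) :
    Irreducible (algebraMap Z R p) := by
  rw [IsDiscreteValuationRing.irreducible_iff_uniformizer,
    ← IsLocalization.AtPrime.map_eq_maximalIdeal P R]
  conv_lhs => rw [hP]
  rw [Ideal.map_span, Set.image_singleton]

theorem smul_mem_localizedAtPrime_iff {M : Submodule Z Q} {s : Z} (hs : s ∉ P) {x : Q} :
    s • x ∈ localizedAtPrime R P M ↔ x ∈ localizedAtPrime R P M := by
  refine ⟨fun ⟨t, ht, h⟩ => ⟨t * s, mul_notMem_of_isPrime P ht hs, ?_⟩, fun h => ?_⟩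
  · rwa [mul_smul]
  · rw [← IsScalarTower.algebraMap_smul R s x]
    exact smul_mem _ _ h

theorem smul_mk'_smul (a : Z) (s : P.primeCompl) (x : Q) :
    (s : Z) • IsLocalization.mk' R a s • x = a • x := by
  rw [← IsScalarTower.algebraMap_smul R (s : Z), smul_smul, mul_comm, IsLocalization.mk'_spec,
    IsScalarTower.algebraMap_smul]

theorem smul_add_smul_mem_localizedAtPrime_iff (hp : Prime p) (hP : P = Ideal.span {p})
    {e f : Q} {M : Submodule Z Q} {i j : ℕ} {m m' : Z} (hm : ¬ p ∣ m) (hm' : ¬ p ∣ m')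
    (hij : ∀ a b : Z, a • e + b • f ∈ M ↔ p ^ i * m ∣ a ∧ p ^ j * m' ∣ b) (a b : R) :
    a • e + b • f ∈ localizedAtPrime R P M ↔
      algebraMap Z R p ^ i ∣ a ∧ algebraMap Z R p ^ j ∣ b := by
  obtain ⟨a, s, rfl⟩ := IsLocalization.exists_mk'_eq P.primeCompl a
  obtain ⟨b, t, rfl⟩ := IsLocalization.exists_mk'_eq P.primeCompl b
  rw [pow_dvd_mk'_iff hp hP, pow_dvd_mk'_iff hp hP,
    ← smul_mem_localizedAtPrime_iff (mul_notMem_of_isPrime P s.2 t.2)]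
  have e1 : ((s : Z) * t) • (IsLocalization.mk' R a s • e + IsLocalization.mk' R b t • f) =
      ((t : Z) * a) • e + ((s : Z) * b) • f := by
    rw [smul_add, mul_comm (s : Z) t, mul_smul, smul_mk'_smul, mul_comm (t : Z) s, mul_smul (s : Z),
      smul_mk'_smul, smul_smul, smul_smul]
  have hs : ¬ p ∣ (s : Z) := by
    rw [← Ideal.mem_span_singleton, ← hP]
    exact s.2
  have ht : ¬ p ∣ (t : Z) := by
    rw [← Ideal.mem_span_singleton, ← hP]
    exact t.2
  rw [e1, mem_localizedAtPrime]
  simp only [smul_add, smul_smul, hij]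
  rw [exists_mul_dvd_iff hp hP hm hm']
  exact and_congr ⟨hp.pow_dvd_of_dvd_mul_left i ht, fun h => h.mul_left _⟩
    ⟨hp.pow_dvd_of_dvd_mul_left j hs, fun h => h.mul_left _⟩

theorem integralClosure_eq_lowerRootLattice_localizedAtPrime (hp : Prime p)
    (hP : P = Ideal.span {p}) (h2 : (2 : Z) ∉ P) (hQ : (Algebra.traceForm K Q).Nondegenerate)
    [IsLattice K (Subalgebra.toSubmodule A)] {e f : Q}
    (he : e ∈ traceDualSubmodule Z K Q (Subalgebra.toSubmodule A))
    (hf : f ∈ traceDualSubmodule Z K Q (Subalgebra.toSubmodule A))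
    (hspan : traceDualSubmodule Z K Q (Subalgebra.toSubmodule A) ≤
      span Z {e, f} ⊔ Subalgebra.toSubmodule A) {i j : ℕ} {m m' : Z} (hm : ¬ p ∣ m)
    (hm' : ¬ p ∣ m')
    (hij : ∀ a b : Z, a • e + b • f ∈ Subalgebra.toSubmodule A ↔ p ^ i * m ∣ a ∧ p ^ j * m' ∣ b)
    (hpar : i * j = 0 ∨ Odd (i + j)) :
    Subalgebra.toSubmodule (integralClosure R Q) =
      lowerRootLattice K (algebraMap Z R p) (A.localizedAtPrime R P) := by
  have hϖ := irreducible_algebraMap_of_eq_span (R := R) hP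
  have hfg := IsLattice.fg (A := K) (M := Subalgebra.toSubmodule A)
  have hdual := traceDualSubmodule_subalgebra_localizedAtPrime (R := R) (P := P) (K := K) hfg
  have hlat : IsLattice K (Subalgebra.toSubmodule (A.localizedAtPrime R P)) :=
    isLattice_localizedAtPrime (Subalgebra.toSubmodule A)
  have h2R : IsUnit (2 : R) := by
    have := IsLocalization.map_units R (⟨2, h2⟩ : P.primeCompl)
    rwa [map_ofNat] at this
  have he' : e ∈ traceDualSubmodule R K Q (Subalgebra.toSubmodule (A.localizedAtPrime R P)) :=
    hdual ▸ mem_localizedAtPrime_of_mem he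
  have hf' : f ∈ traceDualSubmodule R K Q (Subalgebra.toSubmodule (A.localizedAtPrime R P)) :=
    hdual ▸ mem_localizedAtPrime_of_mem hf
  have hij' := smul_add_smul_mem_localizedAtPrime_iff (R := R) hp hP hm hm' hij
  have hspan' : traceDualSubmodule R K Q (Subalgebra.toSubmodule (A.localizedAtPrime R P)) ≤
      span R {e, f} ⊔ Subalgebra.toSubmodule (A.localizedAtPrime R P) := by
    rw [hdual, localizedAtPrime_eq_span, span_le]
    intro x hx
    obtain ⟨y, hy, z, hz, rfl⟩ := mem_sup.1 (hspan hx)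
    exact add_mem (mem_sup_left (span_le_restrictScalars Z R _ hy))
      (mem_sup_right (mem_localizedAtPrime_of_mem hz))
  rcases hpar with hpar | hpar
  · rcases Nat.mul_eq_zero.1 hpar with rfl | rfl
    -- An exponent zero means that the corresponding generator already lies in the localized order,
    -- so the localized quotient is cyclic.
    · refine integralClosure_eq_lowerRootLattice_of_cyclic hϖ h2R hQ hf' (hspan'.trans ?_)
      refine sup_le (span_le.2 ?_) le_sup_right
      rintro x (rfl | rfl)
      · exact mem_sup_right (by
          have := (hij' 1 0).2 (by simp)
          rwa [one_smul, zero_smul, add_zero] at this)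
      · exact mem_sup_left (mem_span_singleton_self _)
    · refine integralClosure_eq_lowerRootLattice_of_cyclic hϖ h2R hQ he' (hspan'.trans ?_)
      refine sup_le (span_le.2 ?_) le_sup_right
      rintro x (rfl | rfl)
      · exact mem_sup_left (mem_span_singleton_self _)
      · exact mem_sup_right (by
          have := (hij' 0 1).2 (by simp)
          rwa [one_smul, zero_smul, zero_add] at this)
  · exact integralClosure_eq_lowerRootLattice_of_odd hϖ h2R hQ he' hf' hspan' hpar
      (length_quotient_of_generators hϖ he' hf' hspan' hij')

theorem exists_smul_mem_lowerRootLatticeOf_and (hp : Prime p) (hP : P = Ideal.span {p})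
    (h : Subalgebra.toSubmodule (integralClosure R Q) =
      lowerRootLattice K (algebraMap Z R p) (A.localizedAtPrime R P))
    [IsLattice K (Subalgebra.toSubmodule A)] (x : Q) :
    (x ∈ Subalgebra.toSubmodule (integralClosure Z Q) →
      ∃ s ∉ P, s • x ∈ lowerRootLatticeOf K (id : Z → Z) A) ∧
    (x ∈ lowerRootLatticeOf K (id : Z → Z) A →
      ∃ s ∉ P, s • x ∈ Subalgebra.toSubmodule (integralClosure Z Q)) := by
  have hfg := IsLattice.fg (A := K) (M := Subalgebra.toSubmodule A)
  constructor
  · intro hx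
    have hxR : x ∈ Subalgebra.toSubmodule (integralClosure R Q) := IsIntegral.tower_top hx
    rw [h] at hxR
    exact lowerRootLattice_localizedAtPrime_le hfg hxR
  · intro hx
    have hxR : x ∈ Subalgebra.toSubmodule (integralClosure R Q) := by
      rw [h]
      exact lowerRootLatticeOf_le_localizedAtPrime hp hP hfg hx
    obtain ⟨s, hs⟩ := IsIntegral.exists_multiple_integral_of_isLocalization P.primeCompl x hxR
    exact ⟨s, s.2, hs⟩

end LocalGlobal

/-! ### Gluing over the primes of a principal ideal domain. -/

section Global

open Submodule

variable {Z K Q : Type*} [CommRing Z] [IsDomain Z] [IsPrincipalIdealRing Z] [Field K]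
  [Algebra Z K] [IsFractionRing Z K] [CommRing Q] [Algebra K Q] [Algebra Z Q]
  [IsScalarTower Z K Q] {A : Subalgebra Z Q}

theorem exists_smul_mem_of_prime {p : Z} (hp : Prime p) (h2 : ¬ p ∣ 2)
    (hQ : (Algebra.traceForm K Q).Nondegenerate)
    [IsLattice K (Subalgebra.toSubmodule A)] {e f : Q}
    (he : e ∈ traceDualSubmodule Z K Q (Subalgebra.toSubmodule A))
    (hf : f ∈ traceDualSubmodule Z K Q (Subalgebra.toSubmodule A))
    (hspan : traceDualSubmodule Z K Q (Subalgebra.toSubmodule A) ≤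
      span Z {e, f} ⊔ Subalgebra.toSubmodule A) {i j : ℕ} {m m' : Z} (hm : ¬ p ∣ m)
    (hm' : ¬ p ∣ m')
    (hij : ∀ a b : Z, a • e + b • f ∈ Subalgebra.toSubmodule A ↔ p ^ i * m ∣ a ∧ p ^ j * m' ∣ b)
    (hpar : i * j = 0 ∨ Odd (i + j)) (x : Q) :
    (x ∈ Subalgebra.toSubmodule (integralClosure Z Q) →
      ∃ s, ¬ p ∣ s ∧ s • x ∈ lowerRootLatticeOf K (id : Z → Z) A) ∧
    (x ∈ lowerRootLatticeOf K (id : Z → Z) A →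
      ∃ s, ¬ p ∣ s ∧ s • x ∈ Subalgebra.toSubmodule (integralClosure Z Q)) := by
  have hprime : (Ideal.span {p}).IsPrime := (Ideal.span_singleton_prime hp.ne_zero).2 hp
  have hbot : Ideal.span {p} ≠ ⊥ := by simpa using hp.ne_zero
  have hle := (Ideal.span {p}).primeCompl_le_nonZeroDivisors
  let R := Localization.AtPrime (Ideal.span {p})
  have : IsDiscreteValuationRing R :=
    IsLocalization.AtPrime.isDiscreteValuationRing_of_dedekind_domain Z hbot R
  let algRK : Algebra R K := IsLocalization.localizationAlgebraOfSubmonoidLe R K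
    (Ideal.span {p}).primeCompl (nonZeroDivisors Z) hle
  have : IsScalarTower Z R K := IsLocalization.localization_isScalarTower_of_submonoid_le R K
    (Ideal.span {p}).primeCompl (nonZeroDivisors Z) hle
  have : IsFractionRing R K := IsFractionRing.isFractionRing_of_isDomain_of_isLocalization
    (Ideal.span {p}).primeCompl R K
  let algRQ : Algebra R Q := ((algebraMap K Q).comp (algebraMap R K)).toAlgebra
  have : IsScalarTower R K Q := IsScalarTower.of_algebraMap_eq' rfl
  have : IsScalarTower Z R Q := IsScalarTower.of_algebraMap_eq fun z => by
    rw [IsScalarTower.algebraMap_apply R K Q, ← IsScalarTower.algebraMap_apply Z R K,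
      ← IsScalarTower.algebraMap_apply Z K Q]
  simp only [← Ideal.mem_span_singleton] at h2 ⊢
  exact exists_smul_mem_lowerRootLatticeOf_and (R := R) hp rfl
    (integralClosure_eq_lowerRootLattice_localizedAtPrime hp rfl h2 hQ he hf hspan hm hm' hij hpar) x

/-- The ideal of all `s` with `s x ∈ M` contains `N`. A maximal ideal containing it would be
generated by a prime dividing `N`, and the hypothesis excludes each of these. -/
theorem mem_of_forall_prime_exists_smul_mem (M : Submodule Z Q) {N : Z} (hN : N ≠ 0) {x : Q}
    (hNx : N • x ∈ M) (h : ∀ p, Prime p → p ∣ N → ∃ s, ¬ p ∣ s ∧ s • x ∈ M) : x ∈ M := by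
  let I : Ideal Z := M.comap (LinearMap.toSpanSingleton Z Q x)
  have hI : ∀ s, s ∈ I ↔ s • x ∈ M := fun s => Iff.rfl
  by_contra hx
  have hne : I ≠ ⊤ := fun htop => hx (by
    have : (1 : Z) ∈ I := htop ▸ trivial
    rwa [hI, one_smul] at this)
  obtain ⟨P, hP, hle⟩ := Ideal.exists_le_maximal I hne
  obtain ⟨p, rfl⟩ := (IsPrincipalIdealRing.principal P).principal
  change (Ideal.span {p}).IsMaximal at hP
  change I ≤ Ideal.span {p} at hle
  have hNp : p ∣ N := Ideal.mem_span_singleton.1 (hle ((hI N).2 hNx))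
  have hp0 : p ≠ 0 := by
    rintro rfl
    exact hN (zero_dvd_iff.1 hNp)
  obtain ⟨s, hs, hsx⟩ := h p ((Ideal.span_singleton_prime hp0).1 hP.isPrime) hNp
  exact hs (Ideal.mem_span_singleton.1 (hle ((hI s).2 hsx)))

/-- The global theorem over a principal ideal domain. -/
theorem integralClosure_eq_lowerRootLatticeOf (hQ : (Algebra.traceForm K Q).Nondegenerate)
    [IsLattice K (Subalgebra.toSubmodule A)] {e f : Q}
    (he : e ∈ traceDualSubmodule Z K Q (Subalgebra.toSubmodule A))
    (hf : f ∈ traceDualSubmodule Z K Q (Subalgebra.toSubmodule A))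
    (hspan : traceDualSubmodule Z K Q (Subalgebra.toSubmodule A) ≤
      span Z {e, f} ⊔ Subalgebra.toSubmodule A) {m m' : Z} (hm0 : m ≠ 0) (hm0' : m' ≠ 0)
    (hmem : ∀ a b : Z, a • e + b • f ∈ Subalgebra.toSubmodule A ↔ m ∣ a ∧ m' ∣ b)
    (hpar : ∀ p : Z, Prime p → p ∣ m * m' → ¬ p ∣ 2 ∧
      (multiplicity p m * multiplicity p m' = 0 ∨ Odd (multiplicity p m + multiplicity p m'))) :
    Subalgebra.toSubmodule (integralClosure Z Q) = lowerRootLatticeOf K (id : Z → Z) A := by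
  have hAO : Subalgebra.toSubmodule A ≤ Subalgebra.toSubmodule (integralClosure Z Q) :=
    le_integralClosure_of_isLattice (K := K) A
  have hOD := (integralClosure_le_traceDualSubmodule (K := K) A).trans
    (traceDualSubmodule_integralClosure_le (K := K) A)
  have hAL : Subalgebra.toSubmodule A ≤ lowerRootLatticeOf K (id : Z → Z) A := le_sup_left
  have hLD : lowerRootLatticeOf K (id : Z → Z) A ≤
      traceDualSubmodule Z K Q (Subalgebra.toSubmodule A) :=
    lowerRootLatticeOf_le_iff.2 ⟨hAO.trans hOD, fun _ _ hy _ => smul_mem _ _ hy⟩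
  have hN : m * m' ≠ 0 := mul_ne_zero hm0 hm0'
  -- The quotient is killed by `m m'`, so only the primes dividing it have to be examined, and these
  -- are the only ones required not to divide `2`.
  have hND : ∀ x ∈ traceDualSubmodule Z K Q (Subalgebra.toSubmodule A),
      (m * m') • x ∈ Subalgebra.toSubmodule A := by
    intro x hx
    obtain ⟨a, b, z, hz, rfl⟩ := exists_eq_of_le_span_pair hspan hx
    rw [smul_add]
    refine add_mem ?_ (smul_mem _ _ hz)
    rw [smul_add, smul_smul, smul_smul, hmem]
    exact ⟨⟨m' * a, by ring⟩, ⟨m * b, by ring⟩⟩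
  have hloc : ∀ p : Z, Prime p → p ∣ m * m' → ∀ x : Q,
      (x ∈ Subalgebra.toSubmodule (integralClosure Z Q) →
        ∃ s, ¬ p ∣ s ∧ s • x ∈ lowerRootLatticeOf K (id : Z → Z) A) ∧
      (x ∈ lowerRootLatticeOf K (id : Z → Z) A →
        ∃ s, ¬ p ∣ s ∧ s • x ∈ Subalgebra.toSubmodule (integralClosure Z Q)) := by
    intro p hp hpN
    obtain ⟨h2, hodd⟩ := hpar p hp hpN
    obtain ⟨c, hc, hcp⟩ :=
      (FiniteMultiplicity.of_not_isUnit hp.not_isUnit hm0).exists_eq_pow_mul_and_not_dvd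
    obtain ⟨d, hd, hdp⟩ :=
      (FiniteMultiplicity.of_not_isUnit hp.not_isUnit hm0').exists_eq_pow_mul_and_not_dvd
    refine exists_smul_mem_of_prime hp h2 hQ he hf hspan hcp hdp (fun a b => ?_) hodd
    rw [← hc, ← hd, hmem]
  apply le_antisymm
  · intro x hx
    exact mem_of_forall_prime_exists_smul_mem _ hN (hAL (hND x (hOD hx)))
      fun p hp hpN => (hloc p hp hpN x).1 hx
  · intro x hx
    exact mem_of_forall_prime_exists_smul_mem _ hN (hAO (hND x (hLD hx)))
      fun p hp hpN => (hloc p hp hpN x).2 hx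

end Global

/-! ### Orders over the integers and the rings generated by one algebraic integer. -/

section Integers

open Submodule

theorem closureQuotientEq_lowerRootInt (A Q : Type*) [CommRing A] [CommRing Q] [Algebra A Q]
    [IsFractionRing A Q] [Algebra ℚ Q] (h : IsOrderOver ℤ A ℚ Q)
    (hB : IsOddAlternating (DualQuotient ℤ A ℚ Q)) :
    ClosureQuotientEq ℤ A ℚ Q (lowerRootInt (DualQuotient ℤ A ℚ Q)) := by
  have := h.finite
  have hQ := h.etale.2
  have hlat := isLattice_orderSubmodule (R := ℤ) (A := A) (K := ℚ) (Q := Q)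
  have hAO := le_integralClosure_of_isLattice (K := ℚ) (orderSubalgebra ℤ A Q)
  have hOD := (integralClosure_le_traceDualSubmodule (K := ℚ) (orderSubalgebra ℤ A Q)).trans
    (traceDualSubmodule_integralClosure_le (K := ℚ) (orderSubalgebra ℤ A Q))
  obtain ⟨hodd, m, m', hm, hm', ⟨ψ⟩, hpar⟩ := hB
  rw [Nat.card_congr ψ.toEquiv, Nat.card_prod, Nat.card_zmod, Nat.card_zmod] at hodd
  refine closureQuotientEq_of_eq (id : ℤ → ℤ) hAO hOD ?_
  let q := ((orderSubmodule ℤ A Q).submoduleOf (orderDual ℤ A ℚ Q)).mkQ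
  obtain ⟨⟨e, he⟩, heq⟩ := mkQ_surjective _ (ψ.symm (1, 0))
  obtain ⟨⟨f, hf⟩, hfq⟩ := mkQ_surjective _ (ψ.symm (0, 1))
  have hψ : ∀ a b : ℤ, ψ (q (a • ⟨e, he⟩ + b • ⟨f, hf⟩)) = ((a : ZMod m), (b : ZMod m')) := by
    intro a b
    have h1 : ψ (q (a • ⟨e, he⟩)) = a • ((1, 0) : ZMod m × ZMod m') := by
      rw [map_smul, ← ψ.apply_symm_apply (1, 0), ← heq]
      exact map_zsmul ψ a _
    have h2 : ψ (q (b • ⟨f, hf⟩)) = b • ((0, 1) : ZMod m × ZMod m') := by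
      rw [map_smul, ← ψ.apply_symm_apply (0, 1), ← hfq]
      exact map_zsmul ψ b _
    rw [map_add, map_add, h1, h2]
    simp
  have hq : ∀ (x : Q) (hx : x ∈ orderDual ℤ A ℚ Q), q ⟨x, hx⟩ = 0 ↔ x ∈ orderSubmodule ℤ A Q :=
    fun x hx => Submodule.Quotient.mk_eq_zero _
  refine integralClosure_eq_lowerRootLatticeOf (K := ℚ) hQ he hf ?_ (m := m) (m' := m')
    (by exact_mod_cast hm.ne') (by exact_mod_cast hm'.ne') ?_ ?_
  · intro x hx
    obtain ⟨a, ha⟩ := ZMod.intCast_surjective (ψ (q ⟨x, hx⟩)).1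
    obtain ⟨b, hb⟩ := ZMod.intCast_surjective (ψ (q ⟨x, hx⟩)).2
    have h1 := hψ a b
    rw [ha, hb, Prod.mk.eta] at h1
    have h2 := (Submodule.Quotient.eq _).1 (ψ.injective h1).symm
    rw [← add_sub_cancel (a • e + b • f) x]
    exact add_mem (mem_sup_left (mem_span_pair.2 ⟨a, b, rfl⟩)) (mem_sup_right h2)
  · intro a b
    have h1 := hq (a • e + b • f) (add_mem (smul_mem _ a he) (smul_mem _ b hf))
    rw [toSubmodule_orderSubalgebra, ← h1, ← ψ.map_eq_zero_iff]
    have h2 := hψ a b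
    erw [h2]
    rw [Prod.mk_eq_zero, ZMod.intCast_zmod_eq_zero_iff_dvd, ZMod.intCast_zmod_eq_zero_iff_dvd]
  · intro p hp hpm
    have hpn := Int.prime_iff_natAbs_prime.1 hp
    have hpm' : p.natAbs ∣ m * m' := by
      rw [← Int.natCast_dvd_natCast, Int.natAbs_dvd]
      exact_mod_cast hpm
    -- Prime elements of `ℤ` carry a sign, so the parity condition on natural primes is transferred
    -- through `natAbs`.
    have hmult : ∀ n : ℕ, n ≠ 0 → multiplicity p (n : ℤ) = n.factorization p.natAbs := by
      intro n hn
      have hdvd : ∀ k, p ^ k ∣ (n : ℤ) ↔ p.natAbs ^ k ∣ n := fun k => by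
        rw [← Int.natAbs_dvd_natAbs, Int.natAbs_pow, Int.natAbs_natCast]
      exact multiplicity_eq_of_dvd_of_not_dvd ((hdvd _).2 (Nat.ordProj_dvd n _))
        fun h => Nat.pow_succ_factorization_not_dvd hn hpn ((hdvd _).1 h)
    rw [hmult m hm.ne', hmult m' hm'.ne']
    refine ⟨fun h2 => ?_, hpar _ hpn⟩
    have : p.natAbs ∣ 2 := by
      rwa [← Int.natCast_dvd_natCast, Int.natAbs_dvd]
    rw [(Nat.prime_dvd_prime_iff_eq hpn Nat.prime_two).1 this] at hpm'
    exact (Nat.not_even_iff_odd.2 hodd) (even_iff_two_dvd.2 hpm')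

/-- Every element of `K` is a polynomial in `α` with rational coefficients, and clearing
denominators by an integer puts it in `ℤ[α]`. -/
theorem isFractionRing_adjoin_int {K : Type*} [Field K] [NumberField K] {α : K}
    (hα : IsIntegral ℤ α) (hK : IntermediateField.adjoin ℚ {α} = ⊤) :
    IsFractionRing (Algebra.adjoin ℤ {α}) K := by
  refine IsFractionRing.of_field _ _ fun z => ?_
  have hz : z ∈ Algebra.adjoin ℚ {α} := by
    rw [← IntermediateField.adjoin_simple_toSubalgebra_of_isAlgebraic
      (hα.tower_top (A := ℚ)).isAlgebraic, hK]
    trivial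
  suffices h : ∃ n : ℤ, n ≠ 0 ∧ (n : K) * z ∈ Algebra.adjoin ℤ {α} by
    obtain ⟨n, hn, h⟩ := h
    refine ⟨⟨_, h⟩, n, ?_⟩
    have hnK : (n : K) ≠ 0 := by exact_mod_cast hn
    rw [map_intCast]
    change z = (n : K) * z / n
    field_simp
  have hint : ∀ n : ℤ, (n : K) ∈ Algebra.adjoin ℤ {α} := fun n => by
    simp
  induction hz using Algebra.adjoin_induction with
  | mem x hx => exact ⟨1, one_ne_zero, by simpa using Algebra.subset_adjoin hx⟩
  | algebraMap r =>
    refine ⟨r.den, by exact_mod_cast r.den_nz, ?_⟩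
    have : ((r.den : ℤ) : K) * algebraMap ℚ K r = (r.num : K) := by
      rw [eq_ratCast]
      exact_mod_cast congrArg (fun t : ℚ => (t : K)) (Rat.den_mul_eq_num r)
    rw [this]
    exact hint _
  | add x y _ _ hx hy =>
    obtain ⟨a, ha, hx⟩ := hx
    obtain ⟨b, hb, hy⟩ := hy
    refine ⟨a * b, mul_ne_zero ha hb, ?_⟩
    have e : ((a * b : ℤ) : K) * (x + y) = b * (a * x) + a * (b * y) := by
      push_cast
      ring
    rw [e]
    exact add_mem (mul_mem (hint b) hx) (mul_mem (hint a) hy)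
  | mul x y _ _ hx hy =>
    obtain ⟨a, ha, hx⟩ := hx
    obtain ⟨b, hb, hy⟩ := hy
    refine ⟨a * b, mul_ne_zero ha hb, ?_⟩
    have e : ((a * b : ℤ) : K) * (x * y) = (a * x) * (b * y) := by
      push_cast
      ring
    rw [e]
    exact mul_mem hx hy

theorem closureQuotientEq_adjoin {K : Type*} [Field K] [NumberField K] {α : K}
    (hα : IsIntegral ℤ α) (hK : IntermediateField.adjoin ℚ {α} = ⊤)
    (hB : IsOddAlternating (DualQuotient ℤ (Algebra.adjoin ℤ {α}) ℚ K)) :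
    ClosureQuotientEq ℤ (Algebra.adjoin ℤ {α}) ℚ K
      (lowerRootInt (DualQuotient ℤ (Algebra.adjoin ℤ {α}) ℚ K)) := by
  have := isFractionRing_adjoin_int hα hK
  refine closureQuotientEq_lowerRootInt (Algebra.adjoin ℤ {α}) K ⟨?_, ?_, ?_⟩ hB
  · exact Module.Finite.iff_fg.2 hα.fg_adjoin_singleton
  · infer_instance
  · exact ⟨inferInstance, traceForm_nondegenerate ℚ K⟩

end Integers
theorem mainTheorem6 :
    -- the local result, over a discrete valuation ring
    (∀ (R A K Q : Type*) [CommRing R] [IsDomain R] [IsDiscreteValuationRing R]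
        [CommRing A] [Algebra R A] [Field K] [Algebra R K] [IsFractionRing R K]
        [CommRing Q] [Algebra A Q] [IsFractionRing A Q] [Algebra K Q] [Algebra R Q]
        [IsScalarTower R A Q] [IsScalarTower R K Q],
      IsOrderOver R A K Q →
      ringChar (IsLocalRing.ResidueField R) ≠ 2 →
      ((∃ x : DualQuotient R A K Q, Submodule.span R {x} = ⊤) ∨
        ((∃ x y : DualQuotient R A K Q, Submodule.span R {x, y} = ⊤) ∧
          ∃ l : ℕ, Odd l ∧ Module.length R (DualQuotient R A K Q) = l)) →
      ClosureQuotientEq R A K Q (lowerRoot R (DualQuotient R A K Q))) ∧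
    -- the global result, for orders over the integers
    (∀ (A Q : Type*) [CommRing A] [CommRing Q] [Algebra A Q] [IsFractionRing A Q] [Algebra ℚ Q],
      IsOrderOver ℤ A ℚ Q →
      IsOddAlternating (DualQuotient ℤ A ℚ Q) →
      ClosureQuotientEq ℤ A ℚ Q (lowerRootInt (DualQuotient ℤ A ℚ Q))) ∧
    -- the case of the order generated by one algebraic integer
    (∀ (K : Type*) [Field K] [NumberField K] (α : K),
      IsIntegral ℤ α → IntermediateField.adjoin ℚ {α} = ⊤ →
      IsOddAlternating (DualQuotient ℤ (Algebra.adjoin ℤ {α}) ℚ K) →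
      ClosureQuotientEq ℤ (Algebra.adjoin ℤ {α}) ℚ K
        (lowerRootInt (DualQuotient ℤ (Algebra.adjoin ℤ {α}) ℚ K))) := by
  refine ⟨?_, ?_, ?_⟩
  · intro R A K Q _ _ _ _ _ _ _ _ _ _ _ _ _ _ _ h hchar hgen
    exact closureQuotientEq_lowerRoot R A K Q h hchar hgen
  · intro A Q _ _ _ _ _ h hB
    exact closureQuotientEq_lowerRootInt A Q h hB
  · intro K _ _ α hα hK hB
    exact closureQuotientEq_adjoin hα hK hB
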